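/- Let $\mathcal B$ be a unital $C^*$-algebra and let $\mathcal B\langle X\rangle$ be the algebraic free product of $\mathcal B$ with $\mathbb C[X]$. For $\lambda_i\in\mathcal B$ and linear maps $\alpha_i:\mathcal B\to\mathcal B$ ($i\ge 1$), the Jacobi--Szegő distribution $$J\begin{pmatrix}\lambda_1,&\lambda_2,&\lambda_3,&\dots\\ \alpha_1,&\alpha_2,&\alpha_3,&\dots\end{pmatrix}:\mathcal B\langle X\rangle\to\mathcal B$$ is the linear map that sends $b_0Xb_1X\cdots Xb_n$ to the degree-$0$ component of $b_0xb_1x\cdots xb_n\,1_{\mathcal B}$. Here $x=a^*+p+a$ acts on the vector space $\mathcal B\langle X\rangle$, graded by the degree in $X$, by $a^*(\xi)=X\xi$, $p(b_0X\cdots Xb_n)=\lambda_{n+1}b_0X\cdots Xb_n$, $a(b_0Xb_1X\cdots Xb_n)=\alpha_n[b_0]b_1X\cdots Xb_n$ for $n\ge1$, and $a(b)=0$ for $b\in\mathcal B$. Let $\lambda_1,\lambda\in\mathcal B$ be self-adjoint and let $\alpha:\mathcal B\to\mathcal B$ be completely positive. For each $N$ let $l_{1,N},l_{2,N}\in\mathcal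 B$ be self-adjoint and let $\alpha_N:\mathcal B\to\mathcal B$ be completely positive, with $$l_{1,N}=\tfrac1N\lambda_1+o(\tfrac1N),\qquad l_{2,N}=\tfrac1N\lambda_1+\lambda+o(1),\qquad \alpha_N[b]=\tfrac1N\alpha[b]+o(\tfrac1N)\ \text{ for every } b\in\mathcal B$$ in norm as $N\to\infty$, and let $\mu_N$ be the $\mathcal B$-valued Bernoulli distribution $$\mu_N=J\begin{pmatrix} l_{1,N},& l_{2,N},&0,&0,&\dots\\ \alpha_N,&0,&0,&0,&\dots\end{pmatrix}.$$ For each $N$ the free convolution power $\mu_N^{\boxplus N}$ is well defined: there is exactly one linear map $\mathcal B\langle X\rangle\to\mathcal B$ that is the distribution $P\mapsto E[P(x_1+\dots+x_N)]$ of a sum of $N$ random variables $x_1,\dots,x_N$ that are free over $\mathcal B$ and all have distribution $\mu_N$, in some $\mathcal B$-valued probability space $(\mathcal A,E,\mathcal B)$ (a unital complex algebra $\mathcal A\supseteq\mathcal B$ with a linear $\mathcal B$-bimodule map $E:\mathcal A\to\mathcal B$ that is the identity on $\mathcal B$). Moreover $\mu_N^{\boxplus N}\to\nu$ as $N\to\infty$,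 that is, $\|\mu_N^{\boxplus N}[P]-\nu[P]\|\to0$ for every $P\in\mathcal B\langle X\rangle$, where $\nu$ is the free Poisson distribution with mean $\lambda_1$ and parameters $(\lambda,\alpha)$, $$\nu=J\begin{pmatrix}\lambda_1,&\lambda_1+\lambda,&\lambda_1+\lambda,&\dots\\ \alpha,&\alpha,&\alpha,&\dots\end{pmatrix}.$$ -/

import Mathlib

open Filter Topology Asymptotics
open scoped TensorProduct DirectSum CStarAlgebra

universe u

noncomputable section

/-! ### The algebra `B⟨X⟩` of non-commutative polynomials with coefficients in `B` -/

/-- The two factors of the free product `B⟨X⟩`: the algebra `B` and the algebra `ℂ[X]`, the latter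
realised as the free algebra on one generator. -/
def NCFactor (B : Type u) : Bool → Type u
  | true => B
  | false => FreeAlgebra ℂ PUnit.{u + 1}

instance NCFactor.instRing (B : Type u) [Ring B] : ∀ i, Ring (NCFactor B i)
  | true => inferInstanceAs (Ring B)
  | false => inferInstanceAs (Ring (FreeAlgebra ℂ PUnit.{u + 1}))

instance NCFactor.instAlgebra (B : Type u) [Ring B] [Algebra ℂ B] : ∀ i, Algebra ℂ (NCFactor B i)
  | true => inferInstanceAs (Algebra ℂ B)
  | false => inferInstanceAs (Algebra ℂ (FreeAlgebra ℂ PUnit.{u + 1}))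

/-- `B⟨X⟩`: the algebraic free product of `B` with the polynomials in one symbol `X`. -/
abbrev NCPoly (B : Type u) [Ring B] [Algebra ℂ B] : Type u :=
  LinearAlgebra.FreeProduct ℂ (NCFactor B)

/-- The inclusion `B → B⟨X⟩`. -/
def NCPoly.C (B : Type u) [Ring B] [Algebra ℂ B] : B →ₐ[ℂ] NCPoly B :=
  LinearAlgebra.FreeProduct.ι ℂ (NCFactor B) true

/-- The symbol `X`. -/
def NCPoly.X (B : Type u) [Ring B] [Algebra ℂ B] : NCPoly B :=
  LinearAlgebra.FreeProduct.ι ℂ (NCFactor B) false (FreeAlgebra.ι ℂ PUnit.unit)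

/-- The homomorphisms out of the two factors that are given by `j` on `B` and by `X ↦ a`. -/
def NCPoly.evalFactor {B : Type u} [Ring B] [Algebra ℂ B] {A : Type*} [Ring A] [Algebra ℂ A]
    (j : B →ₐ[ℂ] A) (a : A) : ∀ {i : Bool}, NCFactor B i →ₐ[ℂ] A
  | true => j
  | false => FreeAlgebra.lift ℂ (fun _ : PUnit.{u + 1} => a)

/-- Evaluation `b₀ X b₁ X ⋯ X bₙ ↦ j(b₀) a j(b₁) a ⋯ a j(bₙ)` of non-commutative polynomials in an
algebra `A` that receives `B` through `j`. -/
def NCPoly.eval {B : Type u} [Ring B] [Algebra ℂ B] {A : Type*} [Ring A] [Algebra ℂ A]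
    (j : B →ₐ[ℂ] A) (a : A) : NCPoly B →ₐ[ℂ] A :=
  LinearAlgebra.FreeProduct.lift ℂ (NCFactor B) (NCPoly.evalFactor j a)

/-! ### Jacobi–Szegő distributions

The vector space `B⟨X⟩` is graded by the degree in `X`, and its component of degree `n` is the
`(n+1)`-fold tensor power of `B` over `ℂ`: the word `b₀ X b₁ X ⋯ X bₙ` is `b₀ ⊗ (b₁ ⊗ (⋯ ⊗ bₙ))`.
-/

/-- The component of degree `n`: `T₀ = B` and `Tₙ₊₁ = B ⊗ Tₙ`. -/
def fockLevel (B : Type u) [Ring B] [Algebra ℂ B] : ℕ → ModuleCat.{u} ℂ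
  | 0 => ModuleCat.of ℂ B
  | n + 1 => ModuleCat.of ℂ (B ⊗[ℂ] fockLevel B n)

/-- Left multiplication `b · (b₀ X b₁ ⋯ X bₙ) = (b b₀) X b₁ ⋯ X bₙ` in degree `n`. -/
def levelMul (B : Type u) [Ring B] [Algebra ℂ B] :
    ∀ n : ℕ, B →ₗ[ℂ] Module.End ℂ (fockLevel B n)
  | 0 => LinearMap.mul ℂ B
  | n + 1 => LinearMap.rTensorHom (fockLevel B n : Type u) ∘ₗ LinearMap.mul ℂ B

/-- `ξ ↦ X ξ = 1 X ξ`, from degree `n` to degree `n + 1`. -/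
def levelCreate (B : Type u) [Ring B] [Algebra ℂ B] (n : ℕ) :
    fockLevel B n →ₗ[ℂ] fockLevel B (n + 1) :=
  TensorProduct.mk ℂ B (fockLevel B n) 1

/-- `b₀ X b₁ X ⋯ X bₙ₊₁ ↦ (α[b₀] b₁) X ⋯ X bₙ₊₁`, from degree `n + 1` to degree `n`. -/
def levelAnnihilate {B : Type u} [Ring B] [Algebra ℂ B] (α : B →ₗ[ℂ] B) (n : ℕ) :
    fockLevel B (n + 1) →ₗ[ℂ] fockLevel B n :=
  TensorProduct.lift (levelMul B n ∘ₗ α)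

/-- The graded space `⨁ₙ Tₙ` of all non-commutative polynomials. -/
abbrev FockSpace (B : Type u) [Ring B] [Algebra ℂ B] : Type u :=
  ⨁ n : ℕ, (fockLevel B n : Type u)

/-- Left multiplication in a fixed degree is multiplicative and unital. -/
theorem levelMul_one (B : Type u) [Ring B] [Algebra ℂ B] (n : ℕ) : levelMul B n 1 = 1 := by
  cases n with
  | zero => exact LinearMap.ext fun x => one_mul (M := B) x
  | succ n =>
    refine TensorProduct.ext' (M := B) (N := fockLevel B n) fun x t => ?_
    change ((1 : B) * x) ⊗ₜ[ℂ] t = x ⊗ₜ[ℂ] t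
    rw [one_mul]

theorem levelMul_mul (B : Type u) [Ring B] [Algebra ℂ B] (n : ℕ) (b c : B) :
    levelMul B n (b * c) = levelMul B n b * levelMul B n c := by
  cases n with
  | zero => exact LinearMap.ext fun x => mul_assoc (G := B) b c x
  | succ n =>
    refine TensorProduct.ext' (M := B) (N := fockLevel B n) fun x t => ?_
    change (b * c * x) ⊗ₜ[ℂ] t = (b * (c * x)) ⊗ₜ[ℂ] t
    rw [mul_assoc]

/-- The left action of `B` on the graded space. -/
def fockMul (B : Type u) [Ring B] [Algebra ℂ B] : B →ₐ[ℂ] Module.End ℂ (FockSpace B) where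
  toFun b := DirectSum.lmap fun n => levelMul B n b
  map_one' := by
    refine DirectSum.linearMap_ext _ fun n => LinearMap.ext fun t => ?_
    simp [levelMul_one]
  map_mul' b c := by
    refine DirectSum.linearMap_ext _ fun n => LinearMap.ext fun t => ?_
    simp [levelMul_mul]
  map_zero' := by
    refine DirectSum.linearMap_ext _ fun n => LinearMap.ext fun t => ?_
    simp
  map_add' b c := by
    refine DirectSum.linearMap_ext _ fun n => LinearMap.ext fun t => ?_
    simp
  commutes' z := by
    refine DirectSum.linearMap_ext _ fun n => LinearMap.ext fun t => ?_
    simp [Algebra.algebraMap_eq_smul_one, levelMul_one]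

/-- The operator `a* : ξ ↦ X ξ`. -/
def creation (B : Type u) [Ring B] [Algebra ℂ B] : Module.End ℂ (FockSpace B) :=
  DirectSum.toModule ℂ ℕ _ fun n =>
    DirectSum.lof ℂ ℕ (fun n => (fockLevel B n : Type u)) (n + 1) ∘ₗ levelCreate B n

/-- The operator `p`, which multiplies words of degree `n` from the left by the `(n+1)`-st
parameter. Sequences of parameters are indexed from `0`, so `lam n` is `λₙ₊₁`. -/
def preservation {B : Type u} [Ring B] [Algebra ℂ B] (lam : ℕ → B) :
    Module.End ℂ (FockSpace B) :=
  DirectSum.lmap fun n => levelMul B n (lam n)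

/-- The operator `a`, which vanishes in degree `0` and sends `b₀ X b₁ X ⋯ X bₙ₊₁` to
`αₙ₊₁[b₀] b₁ X ⋯ X bₙ₊₁`; here `alpha n` is `αₙ₊₁`. -/
def annihilation {B : Type u} [Ring B] [Algebra ℂ B] (alpha : ℕ → B →ₗ[ℂ] B) :
    Module.End ℂ (FockSpace B) :=
  DirectSum.toModule ℂ ℕ _ fun
    | 0 => 0
    | n + 1 => DirectSum.lof ℂ ℕ (fun n => (fockLevel B n : Type u)) n ∘ₗ
        levelAnnihilate (alpha n) n

/-- The vacuum vector `1_B`, a word of degree `0`. -/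
def vacuum (B : Type u) [Ring B] [Algebra ℂ B] : FockSpace B :=
  DirectSum.lof ℂ ℕ (fun n => (fockLevel B n : Type u)) 0 (1 : B)

/-- The component of degree `0`. For the `B`-valued inner product
`⟨b₀ X ⋯ X bₙ, c₀ X ⋯ X cₖ⟩ = δₙₖ bₙ* α₁[bₙ₋₁* ⋯ αₙ[b₀* c₀] ⋯ cₙ₋₁] cₙ`
this is `ξ ↦ ⟨1, ξ⟩`. -/
def vacuumComponent (B : Type u) [Ring B] [Algebra ℂ B] : FockSpace B →ₗ[ℂ] B :=
  DirectSum.component ℂ ℕ (fun n => (fockLevel B n : Type u)) 0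

/-- The Jacobi–Szegő distribution `J(λ₁, λ₂, …; α₁, α₂, …)`, where `λₙ₊₁ = lam n` and
`αₙ₊₁ = alpha n`: it sends `b₀ X b₁ X ⋯ X bₙ` to `⟨1, b₀ x b₁ x ⋯ x bₙ 1⟩` with
`x = a* + p + a`. -/
def jacobi {B : Type u} [Ring B] [Algebra ℂ B] (lam : ℕ → B) (alpha : ℕ → B →ₗ[ℂ] B) :
    NCPoly B →ₗ[ℂ] B :=
  vacuumComponent B ∘ₗ LinearMap.applyₗ (vacuum B) ∘ₗ
    (NCPoly.eval (fockMul B)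
      (creation B + preservation lam + annihilation alpha)).toLinearMap

/-- The `B`-valued Bernoulli distribution `J(l₁, l₂, 0, 0, …; α, 0, 0, …)`. -/
def bernoulliDist {B : Type u} [Ring B] [Algebra ℂ B] (l₁ l₂ : B) (α : B →ₗ[ℂ] B) :
    NCPoly B →ₗ[ℂ] B :=
  jacobi (fun | 0 => l₁ | 1 => l₂ | _ + 2 => 0) (fun | 0 => α | _ + 1 => 0)

/-- The `B`-valued free Poisson distribution with mean `m` and parameters `(l, α)`, that is
`J(m, m + l, m + l, …; α, α, …)`. -/
def freePoissonDist {B : Type u} [Ring B] [Algebra ℂ B] (m l : B) (α : B →ₗ[ℂ] B) :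
    NCPoly B →ₗ[ℂ] B :=
  jacobi (fun | 0 => m | _ + 1 => m + l) (fun _ => α)

/-! ### Free convolution -/

/-- A (purely algebraic) `B`-valued probability space `(A, E, B)`: a unital complex algebra `A`
that contains `B`, with a unital `B`-bimodule map `E : A → B` that restricts to the identity on `B`.
Each C⋆-algebra `A ⊇ B` with a conditional expectation onto `B` is one. -/
structure OVProbSpace (B : Type u) [Ring B] [Algebra ℂ B] where
  A : Type u
  [ring : Ring A]
  [algebra : Algebra ℂ A]
  incl : B →ₐ[ℂ] A
  E : A →ₗ[ℂ] B
  E_incl : ∀ b, E (incl b) = b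
  E_bimodule : ∀ b a c, E (incl b * a * incl c) = b * E a * c

attribute [instance] OVProbSpace.ring OVProbSpace.algebra

/-- The distribution `P ↦ E[P(a)]` of a random variable `a`. -/
def OVProbSpace.dist {B : Type u} [Ring B] [Algebra ℂ B] (S : OVProbSpace B) (a : S.A) :
    NCPoly B →ₗ[ℂ] B :=
  S.E ∘ₗ (NCPoly.eval S.incl a).toLinearMap

/-- Freeness over `B` (with amalgamation) of a family of random variables: each product
`P₁(x_{i₁}) ⋯ Pₙ(x_{iₙ})`, `n ≥ 1`, with `i₁ ≠ i₂ ≠ ⋯ ≠ iₙ` and `E[Pⱼ(x_{iⱼ})] = 0` for all `j`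
has expectation `0`. -/
def OVProbSpace.IsFree {B : Type u} [Ring B] [Algebra ℂ B] (S : OVProbSpace B) {I : Type*}
    (x : I → S.A) : Prop :=
  ∀ w : List (I × NCPoly B), w ≠ [] → w.IsChain (fun p q => p.1 ≠ q.1) →
    (∀ p ∈ w, S.E (NCPoly.eval S.incl (x p.1) p.2) = 0) →
    S.E ((w.map fun p => NCPoly.eval S.incl (x p.1) p.2).prod) = 0

/-- `ρ = μ^{⊞ N}`: the functional `ρ` is the distribution of a sum `x₁ + ⋯ + x_N` of random
variables that are free over `B` and all have distribution `μ`. -/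
def IsFreeConvPower {B : Type u} [Ring B] [Algebra ℂ B] (N : ℕ) (μ ρ : NCPoly B →ₗ[ℂ] B) : Prop :=
  ∃ (S : OVProbSpace B) (x : Fin N → S.A),
    S.IsFree x ∧ (∀ i, S.dist (x i) = μ) ∧ S.dist (∑ i, x i) = ρ

end

/-! ### Evaluation of non-commutative polynomials -/

section Eval

variable {B : Type u} [Ring B] [Algebra ℂ B] {A A' : Type*} [Ring A] [Algebra ℂ A]
  [Ring A'] [Algebra ℂ A']

namespace NCPoly

theorem eval_C (j : B →ₐ[ℂ] A) (a : A) (b : B) : eval j a (C B b) = j b :=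
  DFunLike.congr_fun
    (LinearAlgebra.FreeProduct.lift_comp_ι ℂ (NCFactor B) (maps := evalFactor j a) (i := true)) b

theorem eval_X (j : B →ₐ[ℂ] A) (a : A) : eval j a (X B) = a := by
  have h := DFunLike.congr_fun
    (LinearAlgebra.FreeProduct.lift_comp_ι ℂ (NCFactor B) (maps := evalFactor j a) (i := false))
    (FreeAlgebra.ι ℂ PUnit.unit)
  exact h.trans (FreeAlgebra.lift_ι_apply _ _)

theorem eval_C_mul (j : B →ₐ[ℂ] A) (a : A) (b : B) (P : NCPoly B) :
    eval j a (C B b * P) = j b * eval j a P := by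
  rw [map_mul, eval_C]

theorem eval_mul_C (j : B →ₐ[ℂ] A) (a : A) (b : B) (P : NCPoly B) :
    eval j a (P * C B b) = eval j a P * j b := by
  rw [map_mul, eval_C]

theorem eval_add_C (j : B →ₐ[ℂ] A) (a : A) (b : B) (P : NCPoly B) :
    eval j a (P + C B b) = eval j a P + j b := by
  rw [map_add, eval_C]

theorem algHom_ext {f g : NCPoly B →ₐ[ℂ] A} (hC : ∀ b, f (C B b) = g (C B b))
    (hX : f (X B) = g (X B)) : f = g := by
  apply (LinearAlgebra.FreeProduct.lift ℂ (NCFactor B)).symm.injective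
  have key : ∀ i, f.comp (LinearAlgebra.FreeProduct.ι ℂ (NCFactor B) i) =
      g.comp (LinearAlgebra.FreeProduct.ι ℂ (NCFactor B) i) := by
    rintro (_ | _)
    · exact FreeAlgebra.hom_ext (funext fun _ => hX)
    · exact AlgHom.ext hC
  funext i
  exact key i

theorem map_eval (φ : A →ₐ[ℂ] A') (j : B →ₐ[ℂ] A) (a : A) (P : NCPoly B) :
    φ (eval j a P) = eval (φ.comp j) (φ a) P := by
  have h : φ.comp (eval j a) = eval (φ.comp j) (φ a) :=
    algHom_ext (fun b => by simp [eval_C]) (by simp [eval_X])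
  exact DFunLike.congr_fun h P

theorem eval_mem (S : Subalgebra ℂ A) (j : B →ₐ[ℂ] A) (a : A) (hj : ∀ b, j b ∈ S) (ha : a ∈ S)
    (P : NCPoly B) : eval j a P ∈ S := by
  have h := map_eval S.val (j.codRestrict S hj) ⟨a, ha⟩ P
  have hcomp : S.val.comp (j.codRestrict S hj) = j := AlgHom.ext fun _ => rfl
  rw [hcomp] at h
  exact h ▸ (eval (j.codRestrict S hj) ⟨a, ha⟩ P).2

theorem eval_prod (j : B →ₐ[ℂ] A) (j' : B →ₐ[ℂ] A') (a : A) (a' : A') (P : NCPoly B) :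
    eval (j.prod j') (a, a') P = (eval j a P, eval j' a' P) :=
  Prod.ext (map_eval (AlgHom.fst ℂ A A') _ _ P) (map_eval (AlgHom.snd ℂ A A') _ _ P)

/-- A linear map that intertwines the actions of `B` and of the variable intertwines the actions of
all non-commutative polynomials. -/
theorem eval_intertwine {M M' : Type*} [AddCommGroup M] [Module ℂ M] [AddCommGroup M']
    [Module ℂ M'] (Φ : M →ₗ[ℂ] M') (j : B →ₐ[ℂ] Module.End ℂ M) (j' : B →ₐ[ℂ] Module.End ℂ M')
    (T : Module.End ℂ M) (T' : Module.End ℂ M') (hj : ∀ b v, Φ (j b v) = j' b (Φ v))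
    (hT : ∀ v, Φ (T v) = T' (Φ v)) (P : NCPoly B) (v : M) :
    Φ (eval j T P v) = eval j' T' P (Φ v) := by
  let S : Subalgebra ℂ (Module.End ℂ M × Module.End ℂ M') :=
    { carrier := {p | ∀ v, Φ (p.1 v) = p.2 (Φ v)}
      mul_mem' := fun {p q} hp hq v => by
        change Φ (p.1 (q.1 v)) = p.2 (q.2 (Φ v))
        rw [hp, hq]
      add_mem' := fun {p q} hp hq v => by
        change Φ (p.1 v + q.1 v) = p.2 (Φ v) + q.2 (Φ v)
        rw [map_add, hp, hq]
      algebraMap_mem' := fun z v => by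
        change Φ (z • v) = z • Φ v
        rw [map_smul] }
  have h := eval_mem S (j.prod j') (T, T') hj hT P
  rw [eval_prod] at h
  exact h v

end NCPoly

end Eval

/-! ### Uniqueness of free convolution powers -/

section Uniqueness

variable {B : Type u} [Ring B] [Algebra ℂ B]

namespace OVProbSpace

theorem E_incl_mul (S : OVProbSpace B) (b : B) (a : S.A) : S.E (S.incl b * a) = b * S.E a := by
  have h := S.E_bimodule b a 1
  rwa [map_one, mul_one, mul_one] at h

variable {I : Type*} (S S' : OVProbSpace B) (x : I → S.A) (x' : I → S'.A)

/-- Joint evaluation of a polynomial in the `i`-th variable in two probability spaces. -/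
def pairEval (i : I) : NCPoly B →ₐ[ℂ] S.A × S'.A :=
  NCPoly.eval (S.incl.prod S'.incl) (x i, x' i)

theorem pairEval_apply (i : I) (P : NCPoly B) : pairEval S S' x x' i P =
    (NCPoly.eval S.incl (x i) P, NCPoly.eval S'.incl (x' i) P) :=
  NCPoly.eval_prod _ _ _ _ P

/-- Words in centred polynomials such that neighbouring letters have different indices. -/
def IsCentredWord (w : List (I × NCPoly B)) : Prop :=
  w.IsChain (fun p q => p.1 ≠ q.1) ∧ ∀ p ∈ w, S.E (NCPoly.eval S.incl (x p.1) p.2) = 0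

theorem isCentredWord_cons {i : I} {Q : NCPoly B} {w : List (I × NCPoly B)} :
    IsCentredWord S x ((i, Q) :: w) ↔ (∀ p ∈ w.head?, i ≠ p.1) ∧
      S.E (NCPoly.eval S.incl (x i) Q) = 0 ∧ IsCentredWord S x w := by
  rw [IsCentredWord, IsCentredWord, List.isChain_cons, List.forall_mem_cons]
  tauto

/-- The value of a word in two probability spaces. -/
def pairWord (w : List (I × NCPoly B)) : S.A × S'.A :=
  (w.map fun p => pairEval S S' x x' p.1 p.2).prod

theorem pairWord_nil : pairWord S S' x x' [] = 1 := rfl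

theorem pairWord_cons (i : I) (Q : NCPoly B) (w : List (I × NCPoly B)) :
    pairWord S S' x x' ((i, Q) :: w) = pairEval S S' x x' i Q * pairWord S S' x x' w :=
  List.prod_cons

theorem pairWord_eq (w : List (I × NCPoly B)) : pairWord S S' x x' w =
    ((w.map fun p => NCPoly.eval S.incl (x p.1) p.2).prod,
      (w.map fun p => NCPoly.eval S'.incl (x' p.1) p.2).prod) := by
  induction w with
  | nil => rfl
  | cons p w ih =>
    rw [← Prod.mk.eta (p := p), pairWord_cons, ih, pairEval_apply, Prod.mk_mul_mk, List.map_cons,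
      List.map_cons, List.prod_cons, List.prod_cons]

/-- The span of `B` and of the products of centred words in two probability spaces. -/
def centredSpan : Submodule ℂ (S.A × S'.A) :=
  Submodule.span ℂ (Set.range (S.incl.prod S'.incl) ∪
    {r | ∃ w : List (I × NCPoly B), w ≠ [] ∧ IsCentredWord S x w ∧ r = pairWord S S' x x' w})

variable {S S' x x'}

theorem centredSpan_induction {p : S.A × S'.A → Prop}
    (incl : ∀ b, p (S.incl.prod S'.incl b))
    (word : ∀ w : List (I × NCPoly B), w ≠ [] → IsCentredWord S x w → p (pairWord S S' x x' w))
    (add : ∀ r s, p r → p s → p (r + s)) (smul : ∀ (z : ℂ) r, p r → p (z • r))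
    {r : S.A × S'.A} (hr : r ∈ centredSpan S S' x x') : p r := by
  induction hr using Submodule.span_induction with
  | mem r hr =>
    rcases hr with ⟨b, rfl⟩ | ⟨w, hne, hw, rfl⟩
    · exact incl b
    · exact word w hne hw
  | zero =>
    have h := smul 0 _ (incl 0)
    rwa [zero_smul] at h
  | add r s _ _ hr hs => exact add r s hr hs
  | smul z r _ hr => exact smul z r hr

theorem incl_mem_centredSpan (b : B) : S.incl.prod S'.incl b ∈ centredSpan S S' x x' :=
  Submodule.subset_span (Or.inl ⟨b, rfl⟩)

theorem pairWord_mem_centredSpan {w : List (I × NCPoly B)} (hw : IsCentredWord S x w) :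
    pairWord S S' x x' w ∈ centredSpan S S' x x' := by
  by_cases h : w = []
  · subst h
    rw [pairWord_nil, ← map_one (S.incl.prod S'.incl)]
    exact incl_mem_centredSpan 1
  · exact Submodule.subset_span (Or.inr ⟨w, h, hw, rfl⟩)

theorem incl_mul_pairWord_mem_centredSpan (b : B) {w : List (I × NCPoly B)}
    (hw : IsCentredWord S x w) :
    S.incl.prod S'.incl b * pairWord S S' x x' w ∈ centredSpan S S' x x' := by
  cases w with
  | nil =>
    rw [pairWord_nil, mul_one]
    exact incl_mem_centredSpan b
  | cons p w =>
    obtain ⟨i, Q⟩ := p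
    obtain ⟨h1, h2, h3⟩ := (isCentredWord_cons S x).1 hw
    have h4 : S.E (NCPoly.eval S.incl (x i) (NCPoly.C B b * Q)) = 0 := by
      rw [NCPoly.eval_C_mul, E_incl_mul, h2, mul_zero]
    have h := pairWord_mem_centredSpan (S' := S') (x' := x')
      ((isCentredWord_cons S x).2 ⟨h1, h4, h3⟩)
    rw [pairWord_cons, pairEval, NCPoly.eval_C_mul, mul_assoc] at h
    rw [pairWord_cons, pairEval]
    exact h

/-- A polynomial in `x i` times a centred word that does not start with the index `i`. -/
theorem pairEval_mul_pairWord_mem_centredSpan (i : I) (P : NCPoly B) {w : List (I × NCPoly B)}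
    (hw : IsCentredWord S x w) (hi : ∀ p ∈ w.head?, i ≠ p.1) :
    pairEval S S' x x' i P * pairWord S S' x x' w ∈ centredSpan S S' x x' := by
  obtain ⟨e, he⟩ : ∃ e, e = S.E (NCPoly.eval S.incl (x i) P) := ⟨_, rfl⟩
  have h0 : S.E (NCPoly.eval S.incl (x i) (P + NCPoly.C B (-e))) = 0 := by
    rw [NCPoly.eval_add_C, map_add, S.E_incl, he, add_neg_cancel]
  have h := add_mem (pairWord_mem_centredSpan (S' := S') (x' := x')
      ((isCentredWord_cons S x).2 ⟨hi, h0, hw⟩))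
    (incl_mul_pairWord_mem_centredSpan (S' := S') (x' := x') e hw)
  rw [pairWord_cons, ← add_mul, pairEval, NCPoly.eval_add_C, map_neg (S.incl.prod S'.incl),
    neg_add_cancel_right] at h
  exact h

theorem pairEval_mul_incl_mem_centredSpan (i : I) (P : NCPoly B) (b : B) :
    pairEval S S' x x' i P * S.incl.prod S'.incl b ∈ centredSpan S S' x x' := by
  have h := pairEval_mul_pairWord_mem_centredSpan (S := S) (S' := S') (x := x) (x' := x') i
    (P * NCPoly.C B b) (w := []) ⟨List.isChain_nil, fun _ hp => absurd hp List.not_mem_nil⟩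
    (fun _ hp => absurd hp (Option.not_mem_none _))
  rw [pairEval, NCPoly.eval_mul_C, pairWord_nil, mul_one] at h
  exact h

theorem pairEval_mul_pairWord_cons_mem_centredSpan (i k : I) (P Q : NCPoly B)
    {w : List (I × NCPoly B)} (hw : IsCentredWord S x ((k, Q) :: w)) :
    pairEval S S' x x' i P * pairWord S S' x x' ((k, Q) :: w) ∈ centredSpan S S' x x' := by
  by_cases hik : i = k
  · subst hik
    obtain ⟨h1, -, h3⟩ := (isCentredWord_cons S x).1 hw
    have h := pairEval_mul_pairWord_mem_centredSpan (S := S) (S' := S') (x := x) (x' := x') i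
      (P * Q) h3 h1
    rw [map_mul (pairEval S S' x x' i), mul_assoc] at h
    rw [pairWord_cons]
    exact h
  · refine pairEval_mul_pairWord_mem_centredSpan i P hw fun p hp => ?_
    rw [List.head?_cons, Option.mem_def, Option.some.injEq] at hp
    subst hp
    exact hik

theorem pairEval_mul_mem_centredSpan (i : I) (P : NCPoly B) {r : S.A × S'.A}
    (hr : r ∈ centredSpan S S' x x') : pairEval S S' x x' i P * r ∈ centredSpan S S' x x' := by
  refine centredSpan_induction (p := fun r => pairEval S S' x x' i P * r ∈ centredSpan S S' x x')
    (fun b => pairEval_mul_incl_mem_centredSpan i P b) (fun w hne hw => ?_)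
    (fun r s hr hs => ?_) (fun z r hr => ?_) hr
  · obtain ⟨⟨k, Q⟩, w, rfl⟩ := List.exists_cons_of_ne_nil hne
    exact pairEval_mul_pairWord_cons_mem_centredSpan i k P Q hw
  · rw [mul_add]
    exact add_mem hr hs
  · rw [mul_smul_comm]
    exact Submodule.smul_mem _ z hr

theorem E_fst_eq_E_snd_of_mem_centredSpan (hx : S.IsFree x) (hx' : S'.IsFree x')
    (hdist : ∀ i, S.dist (x i) = S'.dist (x' i)) {r : S.A × S'.A}
    (hr : r ∈ centredSpan S S' x x') : S.E r.1 = S'.E r.2 := by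
  refine centredSpan_induction (p := fun r => S.E r.1 = S'.E r.2)
    (fun b => ?_) (fun w hne hw => ?_) (fun r s hr hs => ?_) (fun z r hr => ?_) hr
  · exact (S.E_incl b).trans (S'.E_incl b).symm
  · rw [pairWord_eq, hx w hne hw.1 hw.2, hx' w hne hw.1 fun p hp =>
      (DFunLike.congr_fun (hdist p.1) p.2).symm.trans (hw.2 p hp)]
  · rw [Prod.fst_add, Prod.snd_add, map_add, map_add, hr, hs]
  · rw [Prod.smul_fst, Prod.smul_snd, map_smul, map_smul, hr]

/-- The distribution of the sum of free variables is determined by the distributions of the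
summands. -/
theorem dist_sum_eq_of_isFree [Fintype I] (hx : S.IsFree x) (hx' : S'.IsFree x')
    (hdist : ∀ i, S.dist (x i) = S'.dist (x' i)) : S.dist (∑ i, x i) = S'.dist (∑ i, x' i) := by
  let L : Subalgebra ℂ (S.A × S'.A) :=
    { carrier := {r | ∀ v ∈ centredSpan S S' x x', r * v ∈ centredSpan S S' x x'}
      mul_mem' := fun {r s} hr hs v hv => by
        rw [mul_assoc]
        exact hr _ (hs v hv)
      add_mem' := fun {r s} hr hs v hv => by
        rw [add_mul]
        exact add_mem (hr v hv) (hs v hv)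
      algebraMap_mem' := fun z v hv => by
        rw [← Algebra.smul_def]
        exact Submodule.smul_mem _ z hv }
  have hincl : ∀ b, S.incl.prod S'.incl b ∈ L := by
    intro b v hv
    refine centredSpan_induction
      (p := fun v => S.incl.prod S'.incl b * v ∈ centredSpan S S' x x') (fun c => ?_)
      (fun w _ hw => incl_mul_pairWord_mem_centredSpan b hw) (fun r s hr hs => ?_)
      (fun z r hr => ?_) hv
    · rw [← map_mul (S.incl.prod S'.incl)]
      exact incl_mem_centredSpan (b * c)
    · rw [mul_add]
      exact add_mem hr hs
    · rw [mul_smul_comm]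
      exact Submodule.smul_mem _ z hr
  have hsum : ((∑ i, x i, ∑ i, x' i) : S.A × S'.A) ∈ L := by
    have hprod : ((∑ i, x i, ∑ i, x' i) : S.A × S'.A) = ∑ i, (x i, x' i) := by
      ext <;> simp [Prod.fst_sum, Prod.snd_sum]
    rw [hprod]
    refine sum_mem fun i _ v hv => ?_
    have h := pairEval_mul_mem_centredSpan i (NCPoly.X B) hv
    rwa [pairEval, NCPoly.eval_X] at h
  refine LinearMap.ext fun P => ?_
  have hmem := NCPoly.eval_mem L _ _ hincl hsum P 1
    (pairWord_mem_centredSpan (w := []) ⟨List.isChain_nil, by simp⟩)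
  rw [mul_one, NCPoly.eval_prod] at hmem
  exact E_fst_eq_E_snd_of_mem_centredSpan hx hx' hdist hmem

end OVProbSpace

end Uniqueness

/-! ### The coloured Fock space -/

noncomputable section Coloured

variable {B : Type u} [Ring B] [Algebra ℂ B]

/-- Right multiplication `(b₀ X b₁ ⋯ X bₙ) · b = b₀ X b₁ ⋯ X (bₙ b)` in degree `n`. -/
def levelMulRight (c : B) : ∀ n : ℕ, Module.End ℂ (fockLevel B n)
  | 0 => LinearMap.mulRight ℂ c
  | n + 1 => LinearMap.lTensor B (levelMulRight c n)

variable (B) in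
/-- `ξ ↦ b X ξ`, from degree `n` to degree `n + 1`. -/
def levelCons (n : ℕ) : B →ₗ[ℂ] fockLevel B n →ₗ[ℂ] fockLevel B (n + 1) :=
  TensorProduct.mk ℂ B (fockLevel B n)

theorem levelMul_levelCons (n : ℕ) (b c : B) (t : fockLevel B n) :
    levelMul B (n + 1) b (levelCons B n c t) = levelCons B n (b * c) t := rfl

theorem levelMulRight_levelCons (n : ℕ) (b c : B) (t : fockLevel B n) :
    levelMulRight c (n + 1) (levelCons B n b t) = levelCons B n b (levelMulRight c n t) := rfl

theorem levelAnnihilate_levelCons (α : B →ₗ[ℂ] B) (n : ℕ) (b : B) (t : fockLevel B n) :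
    levelAnnihilate α n (levelCons B n b t) = levelMul B n (α b) t := rfl

theorem level_linearMap_ext {n : ℕ} {M : Type*} [AddCommGroup M] [Module ℂ M]
    {f g : fockLevel B (n + 1) →ₗ[ℂ] M}
    (h : ∀ b t, f (levelCons B n b t) = g (levelCons B n b t)) : f = g :=
  TensorProduct.ext' (M := B) (N := fockLevel B n) h

variable (B) in
/-- The space of words `b₀ X_{i₁} b₁ X_{i₂} ⋯ X_{iₙ} bₙ` in variables indexed by `I`: the direct
sum over the words `i₁ ⋯ iₙ` of the tensor powers of `B`. -/
abbrev ColouredFock (I : Type) : Type u :=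
  ⨁ c : List I, (fockLevel B c.length : Type u)

namespace ColouredFock

variable {I : Type} [DecidableEq I]

/-- The inclusion of the component of the word `c`. -/
def comp (c : List I) : fockLevel B c.length →ₗ[ℂ] ColouredFock B I :=
  DirectSum.lof ℂ (List I) (fun c => (fockLevel B c.length : Type u)) c

/-- The inclusion of the component of the word `i :: c`. -/
def compCons (i : I) (c : List I) : fockLevel B (c.length + 1) →ₗ[ℂ] ColouredFock B I :=
  comp (i :: c)

/-- The inclusion of `B` as the component of degree `0`. -/
def base : B →ₗ[ℂ] ColouredFock B I :=
  comp (B := B) (I := I) []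

/-- The operators `ξ ↦ b X_i ξ`. -/
def pre (i : I) : B →ₗ[ℂ] Module.End ℂ (ColouredFock B I) :=
  LinearMap.flip (DirectSum.toModule ℂ (List I) (B →ₗ[ℂ] ColouredFock B I) fun c =>
    LinearMap.flip ((levelCons B c.length).compr₂ (compCons i c)))

theorem pre_comp (i : I) (b : B) (c : List I) (t : fockLevel B c.length) :
    pre i b (comp c t) = compCons i c (levelCons B c.length b t) := by
  rw [pre, LinearMap.flip_apply, comp, DirectSum.toModule_lof]
  rfl

theorem linearMap_ext {M : Type*} [AddCommGroup M] [Module ℂ M] {f g : ColouredFock B I →ₗ[ℂ] M}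
    (h0 : ∀ b, f (base b) = g (base b)) (h1 : ∀ i b ξ, f (pre i b ξ) = g (pre i b ξ)) :
    f = g := by
  refine DirectSum.linearMap_ext _ fun c => ?_
  cases c with
  | nil => exact LinearMap.ext h0
  | cons i c =>
    refine level_linearMap_ext fun b t => ?_
    have h := h1 i b (comp c t)
    rw [pre_comp] at h
    exact h

/-- The left action of `B`. -/
def mul (b : B) : Module.End ℂ (ColouredFock B I) :=
  DirectSum.lmap fun c : List I => levelMul B c.length b

theorem mul_base (b c : B) : mul b (base c : ColouredFock B I) = base (b * c) :=
  DirectSum.lmap_lof ..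

theorem mul_comp (b : B) (c : List I) (t : fockLevel B c.length) :
    mul b (comp c t) = comp c (levelMul B _ b t) :=
  DirectSum.lmap_lof ..

theorem mul_compCons (b : B) (i : I) (c : List I) (t : fockLevel B (c.length + 1)) :
    mul b (compCons i c t) = compCons i c (levelMul B _ b t) :=
  DirectSum.lmap_lof ..

/-- A linear identity that holds on every component. -/
theorem apply_eq_of_comp {M : Type*} [AddCommGroup M] [Module ℂ M]
    {f g : ColouredFock B I →ₗ[ℂ] M} (h : ∀ c t, f (comp c t) = g (comp c t))
    (ξ : ColouredFock B I) : f ξ = g ξ :=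
  LinearMap.congr_fun (DirectSum.linearMap_ext _ fun c => LinearMap.ext (h c)) ξ

theorem mul_pre (b : B) (i : I) (c : B) (ξ : ColouredFock B I) :
    mul b (pre i c ξ) = pre i (b * c) ξ := by
  refine apply_eq_of_comp (f := mul b ∘ₗ pre i c) (g := pre i (b * c)) (fun w t => ?_) ξ
  rw [LinearMap.comp_apply, pre_comp, pre_comp, mul_compCons, levelMul_levelCons]

variable (B I) in
/-- The left action of `B` as a homomorphism of algebras. -/
def mulHom : B →ₐ[ℂ] Module.End ℂ (ColouredFock B I) where
  toFun := mul
  map_one' := linearMap_ext (by simp [mul_base]) (by simp [mul_pre])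
  map_mul' b c := linearMap_ext (by simp [mul_base, mul_assoc]) (by simp [mul_pre, mul_assoc])
  map_zero' := linearMap_ext (by simp [mul_base]) (by simp [mul_pre])
  map_add' b c := linearMap_ext (by simp [mul_base, add_mul]) (by simp [mul_pre, add_mul])
  commutes' z := linearMap_ext (by simp [mul_base, Algebra.algebraMap_eq_smul_one])
    (by simp [mul_pre, Algebra.algebraMap_eq_smul_one])

theorem mulHom_apply (b : B) : mulHom B I b = mul b := rfl

/-- The right action of `B`. -/
def mulRight (c : B) : Module.End ℂ (ColouredFock B I) :=
  DirectSum.lmap fun w : List I => levelMulRight c w.length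

theorem mulRight_comp (c : B) (w : List I) (t : fockLevel B w.length) :
    mulRight c (comp w t) = comp w (levelMulRight c _ t) :=
  DirectSum.lmap_lof ..

theorem mulRight_compCons (c : B) (i : I) (w : List I) (t : fockLevel B (w.length + 1)) :
    mulRight c (compCons i w t) = compCons i w (levelMulRight c _ t) :=
  DirectSum.lmap_lof ..

theorem mulRight_base (c b : B) : mulRight c (base b : ColouredFock B I) = base (b * c) :=
  DirectSum.lmap_lof ..

theorem mulRight_pre (c : B) (i : I) (b : B) (ξ : ColouredFock B I) :
    mulRight c (pre i b ξ) = pre i b (mulRight c ξ) := by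
  refine apply_eq_of_comp (f := mulRight c ∘ₗ pre i b) (g := pre i b ∘ₗ mulRight c)
    (fun w t => ?_) ξ
  rw [LinearMap.comp_apply, LinearMap.comp_apply, mulRight_comp, pre_comp, pre_comp,
    mulRight_compCons, levelMulRight_levelCons]

theorem mulRight_mul (c b : B) (ξ : ColouredFock B I) :
    mulRight c (mul b ξ) = mul b (mulRight c ξ) := by
  have h : mulRight c ∘ₗ mul b = mul b ∘ₗ mulRight (I := I) c :=
    linearMap_ext (by simp [mul_base, mulRight_base, mul_assoc]) (by simp [mul_pre, mulRight_pre])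
  exact LinearMap.congr_fun h ξ

/-- The component of degree `0`. -/
def vacuumPart : ColouredFock B I →ₗ[ℂ] B :=
  DirectSum.component ℂ (List I) (fun c => (fockLevel B c.length : Type u)) []

theorem vacuumPart_base (b : B) : vacuumPart (base b : ColouredFock B I) = b :=
  DirectSum.component.lof_self (M := fun c : List I => (fockLevel B c.length : Type u)) ..

theorem vacuumPart_pre (i : I) (b : B) (ξ : ColouredFock B I) : vacuumPart (pre i b ξ) = 0 := by
  refine apply_eq_of_comp (f := vacuumPart ∘ₗ pre i b) (g := 0) (fun c t => ?_) ξ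
  rw [LinearMap.comp_apply, pre_comp]
  exact (DirectSum.component.of ..).trans (dif_neg (List.cons_ne_nil i c))

theorem vacuumPart_mul (b : B) (ξ : ColouredFock B I) :
    vacuumPart (mul b ξ) = b * vacuumPart ξ := by
  have h : vacuumPart ∘ₗ mul b = LinearMap.mulLeft ℂ b ∘ₗ vacuumPart (I := I) :=
    linearMap_ext (by simp [mul_base, vacuumPart_base]) (by simp [mul_pre, vacuumPart_pre])
  exact LinearMap.congr_fun h ξ

theorem vacuumPart_mulRight (c : B) (ξ : ColouredFock B I) :
    vacuumPart (mulRight c ξ) = vacuumPart ξ * c := by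
  have h : vacuumPart ∘ₗ mulRight c = LinearMap.mulRight ℂ c ∘ₗ vacuumPart (I := I) :=
    linearMap_ext (by simp [mulRight_base, vacuumPart_base])
      (by simp [mulRight_pre, vacuumPart_pre])
  exact LinearMap.congr_fun h ξ

/-- The operator that acts on a word as the Bernoulli operator with parameters `l₁, l₂, α` in the
variable `X_i`: a word that does not start with `X_i` is mapped to `X_i w + l₁ w`, and the word
`b₀ X_i w` to `l₂ b₀ X_i w + α[b₀] w`. -/
def bernoulliOp (l₁ l₂ : B) (α : B →ₗ[ℂ] B) (i : I) : Module.End ℂ (ColouredFock B I) :=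
  DirectSum.toModule ℂ (List I) _ fun
    | [] => (pre i 1 + mul l₁) ∘ₗ comp []
    | k :: c =>
      if i = k then mul l₂ ∘ₗ compCons k c + comp c ∘ₗ levelAnnihilate α c.length
      else (pre i 1 + mul l₁) ∘ₗ compCons k c

variable {l₁ l₂ : B} {α : B →ₗ[ℂ] B}

theorem bernoulliOp_base (i : I) (b : B) : bernoulliOp l₁ l₂ α i (base b) =
    pre i 1 (base b) + base (l₁ * b) := by
  rw [← mul_base]
  exact DirectSum.toModule_lof ..

theorem bernoulliOp_compCons (i k : I) (c : List I) (t : fockLevel B (c.length + 1)) :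
    bernoulliOp l₁ l₂ α i (compCons k c t) =
      if i = k then mul l₂ (compCons k c t) + comp c (levelAnnihilate α c.length t)
      else pre i 1 (compCons k c t) + mul l₁ (compCons k c t) := by
  refine (DirectSum.toModule_lof ..).trans ?_
  dsimp only
  split_ifs <;> rfl

theorem bernoulliOp_pre_self (i : I) (b : B) (ξ : ColouredFock B I) :
    bernoulliOp l₁ l₂ α i (pre i b ξ) = mul l₂ (pre i b ξ) + mul (α b) ξ := by
  refine apply_eq_of_comp (f := bernoulliOp l₁ l₂ α i ∘ₗ pre i b)
    (g := mul l₂ ∘ₗ pre i b + mul (α b)) (fun c t => ?_) ξ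
  rw [LinearMap.comp_apply, LinearMap.add_apply, LinearMap.comp_apply, pre_comp,
    bernoulliOp_compCons, if_pos rfl, mul_comp (α b), levelAnnihilate_levelCons]

theorem bernoulliOp_pre_of_ne {i k : I} (h : i ≠ k) (b : B) (ξ : ColouredFock B I) :
    bernoulliOp l₁ l₂ α i (pre k b ξ) = pre i 1 (pre k b ξ) + mul l₁ (pre k b ξ) := by
  refine apply_eq_of_comp (f := bernoulliOp l₁ l₂ α i ∘ₗ pre k b)
    (g := pre i 1 ∘ₗ pre k b + mul l₁ ∘ₗ pre k b) (fun c t => ?_) ξ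
  rw [LinearMap.comp_apply, LinearMap.add_apply, LinearMap.comp_apply, LinearMap.comp_apply,
    pre_comp, bernoulliOp_compCons, if_neg h]

theorem mulRight_bernoulliOp (c : B) (i : I) (ξ : ColouredFock B I) :
    mulRight c (bernoulliOp l₁ l₂ α i ξ) = bernoulliOp l₁ l₂ α i (mulRight c ξ) := by
  have h : mulRight c ∘ₗ bernoulliOp l₁ l₂ α i = bernoulliOp l₁ l₂ α i ∘ₗ mulRight c := by
    refine linearMap_ext (fun b => ?_) fun k b ξ => ?_
    · simp [bernoulliOp_base, mulRight_base, mulRight_pre, mul_assoc]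
    · by_cases hik : i = k
      · subst hik
        simp [bernoulliOp_pre_self, mulRight_pre, mulRight_mul]
      · simp [bernoulliOp_pre_of_ne hik, mulRight_pre, mulRight_mul]
  exact LinearMap.congr_fun h ξ

/-! ### The probability space of operators that commute with the right action -/

variable (B I) in
/-- The operators on the coloured Fock space that commute with the right action of `B`. -/
def rightLinear : Subalgebra ℂ (Module.End ℂ (ColouredFock B I)) :=
  Subalgebra.centralizer ℂ (Set.range mulRight)

theorem mem_rightLinear {T : Module.End ℂ (ColouredFock B I)} :
    T ∈ rightLinear B I ↔ ∀ c ξ, mulRight c (T ξ) = T (mulRight c ξ) := by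
  rw [rightLinear, Subalgebra.mem_centralizer_iff]
  constructor
  · intro h c ξ
    exact LinearMap.congr_fun (h _ ⟨c, rfl⟩) ξ
  · rintro h _ ⟨c, rfl⟩
    exact LinearMap.ext (h c)

theorem mulHom_mem_rightLinear (b : B) : mulHom B I b ∈ rightLinear B I :=
  mem_rightLinear.2 fun c ξ => mulRight_mul c b ξ

variable (B I) in
/-- The right linear operators with the vacuum expectation. -/
def probSpace : OVProbSpace B where
  A := rightLinear B I
  incl := (mulHom B I).codRestrict (rightLinear B I) mulHom_mem_rightLinear
  E := vacuumPart ∘ₗ LinearMap.applyₗ (base 1) ∘ₗ (rightLinear B I).val.toLinearMap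
  E_incl b := by
    change vacuumPart (mul b (base 1)) = b
    rw [mul_base, vacuumPart_base, mul_one]
  E_bimodule b T c := by
    change vacuumPart (mul b (T.1 (mul c (base 1)))) = b * vacuumPart (T.1 (base 1)) * c
    have h := mem_rightLinear.1 T.2 c (base 1)
    rw [mulRight_base, one_mul] at h
    rw [mul_base, mul_one, ← h, vacuumPart_mul, vacuumPart_mulRight, mul_assoc]

/-- The Bernoulli operators as random variables. -/
def bernoulliVar (l₁ l₂ : B) (α : B →ₗ[ℂ] B) (i : I) : (probSpace B I).A :=
  (⟨bernoulliOp l₁ l₂ α i, mem_rightLinear.2 fun c ξ => mulRight_bernoulliOp c i ξ⟩ :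
    rightLinear B I)

end ColouredFock

end Coloured

/-! ### The operators on the Fock space in terms of levels -/

noncomputable section FockLevels

variable {B : Type u} [Ring B] [Algebra ℂ B]

/-- The linear map on words of positive degree that is given by a bilinear map. -/
def levelLift {n : ℕ} {M : Type*} [AddCommGroup M] [Module ℂ M]
    (f : B →ₗ[ℂ] fockLevel B n →ₗ[ℂ] M) : fockLevel B (n + 1) →ₗ[ℂ] M :=
  TensorProduct.lift f

variable (B) in
/-- The inclusion of the component of degree `n`. -/
def fockIn (n : ℕ) : fockLevel B n →ₗ[ℂ] FockSpace B :=
  DirectSum.lof ℂ ℕ (fun n => (fockLevel B n : Type u)) n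

variable (B) in
/-- The inclusion of `B` as the component of degree `0`. -/
def fockBase : B →ₗ[ℂ] FockSpace B := fockIn B 0

/-- The word `b X c`. -/
def fockOne (b c : B) : FockSpace B := fockIn B 1 (levelCons B 0 b c)

theorem fockSpace_linearMap_ext {M : Type*} [AddCommGroup M] [Module ℂ M]
    {f g : FockSpace B →ₗ[ℂ] M} (h0 : ∀ b : B, f (fockBase B b) = g (fockBase B b))
    (h1 : ∀ n b t, f (fockIn B (n + 1) (levelCons B n b t)) =
      g (fockIn B (n + 1) (levelCons B n b t))) : f = g := by
  refine DirectSum.linearMap_ext _ fun n => ?_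
  cases n with
  | zero => exact LinearMap.ext h0
  | succ n => exact level_linearMap_ext (h1 n)

theorem fockSpace_linearMap_ext_one {M : Type*} [AddCommGroup M] [Module ℂ M]
    {f g : FockSpace B →ₗ[ℂ] M} (h0 : ∀ b : B, f (fockBase B b) = g (fockBase B b))
    (h1 : ∀ b c, f (fockOne b c) = g (fockOne b c))
    (h2 : ∀ n t, f (fockIn B (n + 2) t) = g (fockIn B (n + 2) t)) : f = g := by
  refine fockSpace_linearMap_ext h0 fun n b t => ?_
  cases n with
  | zero => exact h1 b t
  | succ n => exact h2 n _

theorem vacuum_eq : vacuum B = fockBase B 1 := rfl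

theorem fockMul_fockIn (b : B) (n : ℕ) (t : fockLevel B n) :
    fockMul B b (fockIn B n t) = fockIn B n (levelMul B n b t) :=
  DirectSum.lmap_lof ..

theorem fockMul_fockBase (b c : B) : fockMul B b (fockBase B c) = fockBase B (b * c) :=
  fockMul_fockIn b 0 c

theorem fockMul_fockOne (b c d : B) : fockMul B b (fockOne c d) = fockOne (b * c) d :=
  fockMul_fockIn b 1 _

theorem creation_fockIn (n : ℕ) (t : fockLevel B n) :
    creation B (fockIn B n t) = fockIn B (n + 1) (levelCons B n 1 t) :=
  DirectSum.toModule_lof ..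

theorem creation_fockBase (b : B) : creation B (fockBase B b) = fockOne 1 b :=
  creation_fockIn 0 b

theorem creation_fockOne (b c : B) : creation B (fockOne b c) =
    fockIn B 2 (levelCons B 1 1 (levelCons B 0 b c)) :=
  creation_fockIn 1 _

theorem preservation_fockIn (lam : ℕ → B) (n : ℕ) (t : fockLevel B n) :
    preservation lam (fockIn B n t) = fockIn B n (levelMul B n (lam n) t) :=
  DirectSum.lmap_lof ..

theorem preservation_fockBase (lam : ℕ → B) (b : B) :
    preservation lam (fockBase B b) = fockBase B (lam 0 * b) :=
  preservation_fockIn lam 0 b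

theorem preservation_fockOne (lam : ℕ → B) (b c : B) :
    preservation lam (fockOne b c) = fockOne (lam 1 * b) c :=
  preservation_fockIn lam 1 _

theorem annihilation_fockBase (alpha : ℕ → B →ₗ[ℂ] B) (b : B) :
    annihilation alpha (fockBase B b) = 0 :=
  DirectSum.toModule_lof ..

theorem annihilation_fockIn_succ (alpha : ℕ → B →ₗ[ℂ] B) (n : ℕ) (t : fockLevel B (n + 1)) :
    annihilation alpha (fockIn B (n + 1) t) = fockIn B n (levelAnnihilate (alpha n) n t) :=
  DirectSum.toModule_lof ..

theorem annihilation_fockOne (alpha : ℕ → B →ₗ[ℂ] B) (b c : B) :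
    annihilation alpha (fockOne b c) = fockBase B (alpha 0 b * c) :=
  annihilation_fockIn_succ alpha 0 _

theorem levelAnnihilate_zero (n : ℕ) : levelAnnihilate (0 : B →ₗ[ℂ] B) n = 0 :=
  level_linearMap_ext fun b t => by
    rw [levelAnnihilate_levelCons, LinearMap.zero_apply, map_zero, LinearMap.zero_apply,
      LinearMap.zero_apply]

theorem vacuumComponent_fockBase (b : B) : vacuumComponent B (fockBase B b) = b :=
  DirectSum.component.lof_self (M := fun n : ℕ => (fockLevel B n : Type u)) ..

theorem vacuumComponent_fockIn_succ (n : ℕ) (t : fockLevel B (n + 1)) :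
    vacuumComponent B (fockIn B (n + 1) t) = 0 :=
  (DirectSum.component.of ..).trans (dif_neg (Nat.succ_ne_zero n))

theorem vacuumComponent_fockOne (b c : B) : vacuumComponent B (fockOne b c) = 0 :=
  vacuumComponent_fockIn_succ 0 _

end FockLevels

/-! ### The Bernoulli operators are free and have Bernoulli distributions -/

noncomputable section BernoulliFree

namespace ColouredFock

variable {B : Type u} [Ring B] [Algebra ℂ B] {I : Type} [DecidableEq I]

theorem mul_mul (b c : B) (ξ : ColouredFock B I) : mul b (mul c ξ) = mul (b * c) ξ :=
  (LinearMap.congr_fun (map_mul (mulHom B I) b c) ξ).symm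

theorem mul_one_apply (ξ : ColouredFock B I) : mul 1 ξ = ξ :=
  LinearMap.congr_fun (map_one (mulHom B I)) ξ

theorem mul_zero_apply (ξ : ColouredFock B I) : mul 0 ξ = 0 :=
  LinearMap.congr_fun (map_zero (mulHom B I)) ξ

theorem mul_add_apply (b c : B) (ξ : ColouredFock B I) : mul (b + c) ξ = mul b ξ + mul c ξ :=
  LinearMap.congr_fun (map_add (mulHom B I) b c) ξ

theorem mul_smul_apply (z : ℂ) (b : B) (ξ : ColouredFock B I) : mul (z • b) ξ = z • mul b ξ :=
  LinearMap.congr_fun (map_smul (mulHom B I) z b) ξ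

/-- The map `b ↦ b w`, `b₀ X b₁ ↦ b₀ X_i b₁ w` that vanishes on words of higher degree. -/
def branch (i : I) (w : ColouredFock B I) : FockSpace B →ₗ[ℂ] ColouredFock B I :=
  DirectSum.toModule ℂ ℕ _ fun
    | 0 => (mulHom B I).toLinearMap.flip w
    | 1 => levelLift ((pre i).compl₂ ((mulHom B I).toLinearMap.flip w))
    | _ + 2 => 0

theorem branch_zero (i : I) (w : ColouredFock B I) (b : B) :
    branch i w (fockBase B b) = mul b w :=
  DirectSum.toModule_lof ..

theorem branch_one (i : I) (w : ColouredFock B I) (b c : B) :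
    branch i w (fockOne b c) = pre i b (mul c w) :=
  DirectSum.toModule_lof ..

theorem branch_succ_succ (i : I) (w : ColouredFock B I) (n : ℕ) (t : fockLevel B (n + 2)) :
    branch i w (fockIn B (n + 2) t) = 0 :=
  DirectSum.toModule_lof ..

/-- The span of the words that start with `X_i` (after the first coefficient). -/
def headSpan (B : Type u) [Ring B] [Algebra ℂ B] {I : Type} [DecidableEq I] (i : I) :
    Submodule ℂ (ColouredFock B I) :=
  Submodule.span ℂ {ξ | ∃ b η, ξ = pre i b η}

theorem branch_sub_mem_headSpan (i : I) (w : ColouredFock B I) (ξ : FockSpace B) :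
    branch i w ξ - mul (vacuumComponent B ξ) w ∈ headSpan B i := by
  have h : (headSpan B i).mkQ ∘ₗ branch i w = (headSpan B i).mkQ ∘ₗ
      (mulHom B I).toLinearMap.flip w ∘ₗ vacuumComponent B := by
    refine fockSpace_linearMap_ext_one (fun b => ?_) (fun b c => ?_) fun n t => ?_
    · simp only [LinearMap.comp_apply, branch_zero, vacuumComponent_fockBase]
      rfl
    · simp only [LinearMap.comp_apply, vacuumComponent_fockOne, map_zero, branch_one]
      exact (Submodule.Quotient.mk_eq_zero _).2 (Submodule.subset_span ⟨b, mul c w, rfl⟩)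
    · simp only [LinearMap.comp_apply, vacuumComponent_fockIn_succ, map_zero, branch_succ_succ]
  exact (Submodule.Quotient.eq _).1 (LinearMap.congr_fun h ξ)

theorem vacuumPart_of_mem_headSpan {i : I} {ξ : ColouredFock B I} (h : ξ ∈ headSpan B i) :
    vacuumPart ξ = 0 := by
  have hle : headSpan B i ≤ LinearMap.ker vacuumPart := by
    refine Submodule.span_le.2 ?_
    rintro _ ⟨b, η, rfl⟩
    exact vacuumPart_pre i b η
  exact hle h

theorem mul_mem_headSpan {i : I} (b : B) {ξ : ColouredFock B I} (h : ξ ∈ headSpan B i) :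
    mul b ξ ∈ headSpan B i := by
  have hle : headSpan B i ≤ (headSpan B i).comap (mul b) := by
    refine Submodule.span_le.2 ?_
    rintro _ ⟨c, η, rfl⟩
    exact Submodule.subset_span ⟨b * c, η, mul_pre b i c η⟩
  exact hle h

variable (l₁ l₂ : B) (α : B →ₗ[ℂ] B)

theorem bernoulliOp_of_mem_headSpan {i k : I} (hik : i ≠ k) {ξ : ColouredFock B I}
    (h : ξ ∈ headSpan B k) :
    bernoulliOp l₁ l₂ α i ξ = pre i 1 ξ + mul l₁ ξ := by
  have hle : headSpan B k ≤
      LinearMap.eqLocus (bernoulliOp l₁ l₂ α i) (pre i 1 + mul l₁) := by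
    refine Submodule.span_le.2 ?_
    rintro _ ⟨b, η, rfl⟩
    exact bernoulliOp_pre_of_ne hik b η
  exact hle h

/-- Polynomials in a Bernoulli operator, applied to a vector on which it creates. -/
theorem eval_bernoulliOp (i : I) (w : ColouredFock B I)
    (hw : ∀ b, bernoulliOp l₁ l₂ α i (mul b w) = pre i 1 (mul b w) + mul l₁ (mul b w))
    (P : NCPoly B) :
    NCPoly.eval (mulHom B I) (bernoulliOp l₁ l₂ α i) P w =
      branch i w (NCPoly.eval (fockMul B) (creation B +
        preservation (fun | 0 => l₁ | 1 => l₂ | _ + 2 => 0) +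
        annihilation (fun | 0 => α | _ + 1 => 0)) P (vacuum B)) := by
  rw [NCPoly.eval_intertwine (branch i w) (fockMul B) (mulHom B I) _ (bernoulliOp l₁ l₂ α i)
    (fun b v => ?_) (fun v => ?_) P (vacuum B)]
  · rw [vacuum_eq, branch_zero, mul_one_apply]
  · refine LinearMap.congr_fun (f := branch i w ∘ₗ fockMul B b)
      (g := mulHom B I b ∘ₗ branch i w)
      (fockSpace_linearMap_ext_one (fun c => ?_) (fun c d => ?_) fun n t => ?_) v
    · simp only [LinearMap.comp_apply, fockMul_fockBase, branch_zero, mulHom_apply, mul_mul]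
    · simp only [LinearMap.comp_apply, fockMul_fockOne, branch_one, mulHom_apply, mul_pre]
    · simp only [LinearMap.comp_apply, fockMul_fockIn, branch_succ_succ, map_zero]
  · refine LinearMap.congr_fun (f := branch i w ∘ₗ (creation B +
        preservation (fun | 0 => l₁ | 1 => l₂ | _ + 2 => 0) +
        annihilation (fun | 0 => α | _ + 1 => 0)))
      (g := bernoulliOp l₁ l₂ α i ∘ₗ branch i w)
      (fockSpace_linearMap_ext_one (fun c => ?_) (fun c d => ?_) fun n t => ?_) v
    · simp only [LinearMap.comp_apply, LinearMap.add_apply, creation_fockBase,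
        preservation_fockBase, annihilation_fockBase, map_add, add_zero, branch_zero,
        branch_one, hw, mul_mul]
    · simp only [LinearMap.comp_apply, LinearMap.add_apply, creation_fockOne,
        preservation_fockOne, annihilation_fockOne, map_add, branch_succ_succ, branch_zero,
        branch_one, bernoulliOp_pre_self, mul_pre, mul_mul, zero_add]
    · simp only [LinearMap.comp_apply, LinearMap.add_apply, creation_fockIn,
        preservation_fockIn, annihilation_fockIn_succ, map_zero, branch_succ_succ,
        levelAnnihilate_zero, LinearMap.zero_apply, add_zero]

theorem bernoulliOp_mul_base (i : I) (b : B) :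
    bernoulliOp l₁ l₂ α i (mul b (base 1)) =
      pre i 1 (mul b (base 1)) + mul l₁ (mul b (base 1)) := by
  rw [mul_base, bernoulliOp_base, mul_base]

/-- The inclusion of the right linear operators into all operators. -/
def opHom (B : Type u) [Ring B] [Algebra ℂ B] (I : Type) [DecidableEq I] :
    (probSpace B I).A →ₐ[ℂ] Module.End ℂ (ColouredFock B I) :=
  (rightLinear B I).val

theorem opHom_eval (a : (probSpace B I).A) (P : NCPoly B) :
    opHom B I (NCPoly.eval (probSpace B I).incl a P) =
      NCPoly.eval (mulHom B I) (opHom B I a) P :=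
  NCPoly.map_eval (opHom B I) (probSpace B I).incl a P

theorem opHom_bernoulliVar (i : I) :
    opHom B I (bernoulliVar l₁ l₂ α i) = bernoulliOp l₁ l₂ α i := rfl

theorem probSpace_E (a : (probSpace B I).A) :
    (probSpace B I).E a = vacuumPart (opHom B I a (base 1)) := rfl

theorem dist_bernoulliVar (i : I) :
    (probSpace B I).dist (bernoulliVar l₁ l₂ α i) = bernoulliDist l₁ l₂ α := by
  refine LinearMap.ext fun P => ?_
  change (probSpace B I).E (NCPoly.eval (probSpace B I).incl (bernoulliVar l₁ l₂ α i) P) = _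
  rw [probSpace_E, opHom_eval, opHom_bernoulliVar,
    eval_bernoulliOp l₁ l₂ α i _ (bernoulliOp_mul_base l₁ l₂ α i)]
  have h := vacuumPart_of_mem_headSpan (branch_sub_mem_headSpan i (base 1 : ColouredFock B I)
    (NCPoly.eval (fockMul B) (creation B +
        preservation (fun | 0 => l₁ | 1 => l₂ | _ + 2 => 0) +
        annihilation (fun | 0 => α | _ + 1 => 0)) P (vacuum B)))
  rw [map_sub, sub_eq_zero, mul_base, mul_one, vacuumPart_base] at h
  exact h

/-- A centred polynomial in a Bernoulli operator maps vectors on which the operator creates to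
vectors that start with its variable. -/
theorem eval_bernoulliOp_mem_headSpan (i : I) (w : ColouredFock B I)
    (hw : ∀ b, bernoulliOp l₁ l₂ α i (mul b w) = pre i 1 (mul b w) + mul l₁ (mul b w))
    (P : NCPoly B) (hP : bernoulliDist l₁ l₂ α P = 0) :
    NCPoly.eval (mulHom B I) (bernoulliOp l₁ l₂ α i) P w ∈ headSpan B i := by
  rw [eval_bernoulliOp l₁ l₂ α i w hw]
  have h := branch_sub_mem_headSpan i w (NCPoly.eval (fockMul B) (creation B +
        preservation (fun | 0 => l₁ | 1 => l₂ | _ + 2 => 0) +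
        annihilation (fun | 0 => α | _ + 1 => 0)) P (vacuum B))
  have h0 : vacuumComponent B (NCPoly.eval (fockMul B) (creation B +
        preservation (fun | 0 => l₁ | 1 => l₂ | _ + 2 => 0) +
        annihilation (fun | 0 => α | _ + 1 => 0)) P (vacuum B)) = 0 := hP
  rwa [h0, mul_zero_apply, sub_zero] at h

theorem opHom_word_mem_headSpan (w : List (I × NCPoly B))
    (hc : w.IsChain (fun p q => p.1 ≠ q.1))
    (h0 : ∀ p ∈ w, bernoulliDist l₁ l₂ α p.2 = 0) (i : I) (hi : i ∈ w.head?.map Prod.fst) :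
    opHom B I (w.map fun p => NCPoly.eval (probSpace B I).incl
      (bernoulliVar l₁ l₂ α p.1) p.2).prod (base 1) ∈ headSpan B i := by
  induction w generalizing i with
  | nil => simp at hi
  | cons p w ih =>
    obtain ⟨k, P⟩ := p
    rw [List.head?_cons, Option.map_some, Option.mem_def, Option.some.injEq] at hi
    change k = i at hi
    subst hi
    rw [List.map_cons, List.prod_cons, map_mul (opHom B I), opHom_eval, opHom_bernoulliVar,
      Module.End.mul_apply]
    refine eval_bernoulliOp_mem_headSpan l₁ l₂ α k _ (fun b => ?_) P (h0 _ List.mem_cons_self)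
    rw [List.isChain_cons] at hc
    cases w with
    | nil =>
      rw [List.map_nil, List.prod_nil, map_one (opHom B I), Module.End.one_apply]
      exact bernoulliOp_mul_base l₁ l₂ α k b
    | cons q w =>
      exact bernoulliOp_of_mem_headSpan l₁ l₂ α (hc.1 q rfl)
        (mul_mem_headSpan b (ih hc.2 (fun p hp => h0 p (List.mem_cons_of_mem _ hp)) q.1 rfl))

theorem isFree_bernoulliVar :
    (probSpace B I).IsFree fun i : I => bernoulliVar l₁ l₂ α i := by
  intro w hne hc h0
  obtain ⟨p, w, rfl⟩ := List.exists_cons_of_ne_nil hne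
  rw [probSpace_E]
  refine vacuumPart_of_mem_headSpan (opHom_word_mem_headSpan l₁ l₂ α (p :: w) hc
    (fun q hq => ?_) p.1 rfl)
  rw [← dist_bernoulliVar l₁ l₂ α q.1]
  exact h0 q hq

end ColouredFock

end BernoulliFree

/-! ### The distribution of the sum of the Bernoulli operators -/

noncomputable section BernoulliSum

namespace ColouredFock

variable {B : Type u} [Ring B] [Algebra ℂ B] {I : Type} [DecidableEq I] [Fintype I]

/-- The sum over all ways to index the variables of a word `b₀ X b₁ ⋯ X bₙ` such that neighbouring
indices are different, and the first index is not the forbidden one. -/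
def spread : ∀ n : ℕ, Option I → (fockLevel B n →ₗ[ℂ] ColouredFock B I)
  | 0, _ => base (B := B) (I := I)
  | n + 1, o => ∑ j : I, if o = some j then 0 else
      levelLift ((pre j).compl₂ (spread n (some j)))

theorem spread_succ (n : ℕ) (o : Option I) (b : B) (t : fockLevel B n) :
    spread (n + 1) o (levelCons B n b t) =
      ∑ j : I, if o = some j then 0 else pre j b (spread n (some j) t) := by
  rw [spread, LinearMap.sum_apply]
  refine Finset.sum_congr rfl fun j _ => ?_
  split_ifs
  · rfl
  · rfl

theorem mul_spread (b : B) : ∀ (n : ℕ) (o : Option I) (t : fockLevel B n),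
    mul b (spread n o t) = spread n o (levelMul B n b t)
  | 0, _, t => mul_base b t
  | n + 1, o, t => by
    refine LinearMap.congr_fun (f := mul b ∘ₗ spread (n + 1) o)
      (g := spread (n + 1) o ∘ₗ levelMul B (n + 1) b) (level_linearMap_ext fun c s => ?_) t
    rw [LinearMap.comp_apply, LinearMap.comp_apply, levelMul_levelCons, spread_succ, spread_succ,
      map_sum]
    refine Finset.sum_congr rfl fun j _ => ?_
    split_ifs
    · exact map_zero _
    · exact mul_pre b j c _

theorem sum_spread_zero (t : fockLevel B 0) :
    ∑ j : I, spread 0 (some j) t = (Fintype.card I : ℂ) • spread 0 (none : Option I) t := by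
  have h : ∀ j : I, spread 0 (some j) t = spread 0 (none : Option I) t := fun _ => rfl
  rw [Finset.sum_congr rfl fun j _ => h j, Finset.sum_const, Nat.cast_smul_eq_nsmul,
    Finset.card_univ]

theorem sum_spread_succ (n : ℕ) (t : fockLevel B (n + 1)) :
    ∑ j : I, spread (n + 1) (some j) t =
      ((Fintype.card I : ℂ) - 1) • spread (n + 1) (none : Option I) t := by
  have h : ∑ j : I, spread (n + 1) (some j) =
      ((Fintype.card I : ℂ) - 1) • spread (B := B) (n + 1) (none : Option I) := by
    refine level_linearMap_ext fun b t => ?_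
    have h1 : ∀ j : I, spread (n + 1) (some j) (levelCons B n b t) =
        spread (n + 1) (none : Option I) (levelCons B n b t) - pre j b (spread n (some j) t) := by
      intro j
      rw [spread_succ, spread_succ, eq_sub_iff_add_eq]
      have h2 : pre j b (spread n (some j) t) =
          ∑ k : I, if some j = some k then pre k b (spread n (some k) t) else 0 := by
        simp
      rw [h2, ← Finset.sum_add_distrib]
      refine Finset.sum_congr rfl fun k _ => ?_
      by_cases hjk : j = k <;> simp [hjk]
    rw [LinearMap.sum_apply, Finset.sum_congr rfl fun j _ => h1 j, Finset.sum_sub_distrib,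
      Finset.sum_const, Finset.card_univ, LinearMap.smul_apply, sub_smul, one_smul,
      Nat.cast_smul_eq_nsmul, spread_succ]
    simp
  rw [← LinearMap.smul_apply, ← h, LinearMap.sum_apply]

variable (l₁ l₂ : B) (α : B →ₗ[ℂ] B)

theorem sum_bernoulliOp_pre (j : I) (b : B) (ξ : ColouredFock B I) :
    ∑ i : I, bernoulliOp l₁ l₂ α i (pre j b ξ) =
      (∑ i : I, if i = j then 0 else pre i 1 (pre j b ξ)) +
        mul (((Fintype.card I : ℂ) - 1) • l₁ + l₂) (pre j b ξ) + mul (α b) ξ := by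
  have h : ∀ i : I, bernoulliOp l₁ l₂ α i (pre j b ξ) =
      (if i = j then 0 else pre i 1 (pre j b ξ)) + mul l₁ (pre j b ξ) +
        if i = j then mul l₂ (pre j b ξ) + mul (α b) ξ - mul l₁ (pre j b ξ) else 0 := by
    intro i
    by_cases hij : i = j
    · subst hij
      rw [bernoulliOp_pre_self, if_pos rfl, if_pos rfl]
      abel
    · rw [bernoulliOp_pre_of_ne hij, if_neg hij, if_neg hij, add_zero]
  rw [Finset.sum_congr rfl fun i _ => h i, Finset.sum_add_distrib, Finset.sum_add_distrib,
    Finset.sum_const, Finset.card_univ, Finset.sum_ite_eq', if_pos (Finset.mem_univ j),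
    mul_add_apply, mul_smul_apply, sub_smul, one_smul, Nat.cast_smul_eq_nsmul]
  abel

variable (B I) in
/-- The sum over all ways to index the variables such that neighbouring indices are different. -/
def spreadAll : FockSpace B →ₗ[ℂ] ColouredFock B I :=
  DirectSum.toModule ℂ ℕ _ fun n => spread n none

theorem spreadAll_fockIn (n : ℕ) (t : fockLevel B n) :
    spreadAll B I (fockIn B n t) = spread n none t :=
  DirectSum.toModule_lof ..

theorem spreadAll_fockBase (b : B) : spreadAll B I (fockBase B b) = base b :=
  spreadAll_fockIn 0 b

theorem vacuumPart_spreadAll (ξ : FockSpace B) :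
    vacuumPart (spreadAll B I ξ) = vacuumComponent B ξ := by
  refine LinearMap.congr_fun (f := vacuumPart ∘ₗ spreadAll B I) (fockSpace_linearMap_ext
    (fun b => ?_) fun n b t => ?_) ξ
  · rw [LinearMap.comp_apply, spreadAll_fockBase, vacuumPart_base, vacuumComponent_fockBase]
  · rw [LinearMap.comp_apply, spreadAll_fockIn, vacuumComponent_fockIn_succ, spread_succ, map_sum]
    exact Finset.sum_eq_zero fun j _ => (if_neg (Option.some_ne_none j).symm).symm ▸
      vacuumPart_pre j b _

theorem spreadAll_fockMul (b : B) (ξ : FockSpace B) :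
    spreadAll B I (fockMul B b ξ) = mul b (spreadAll B I ξ) := by
  refine LinearMap.congr_fun (f := spreadAll B I ∘ₗ fockMul B b) (g := mul b ∘ₗ spreadAll B I)
    (DirectSum.linearMap_ext _ fun n => LinearMap.ext fun t => ?_) ξ
  change spreadAll B I (fockMul B b (fockIn B n t)) = mul b (spreadAll B I (fockIn B n t))
  rw [fockMul_fockIn, spreadAll_fockIn, spreadAll_fockIn, mul_spread]

/-- The sum of the annihilation terms of the Bernoulli operators. -/
theorem sum_mul_spread (n : ℕ) (b : B) (t : fockLevel B n) :
    ∑ j : I, mul (α b) (spread n (some j) t) = spreadAll B I (fockIn B n (levelMul B n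
      ((fun | 0 => (Fintype.card I : ℂ) • α | _ + 1 => ((Fintype.card I : ℂ) - 1) • α :
        ℕ → B →ₗ[ℂ] B) n b) t)) := by
  rw [← map_sum, spreadAll_fockIn, ← mul_spread]
  cases n with
  | zero =>
    rw [sum_spread_zero, map_smul]
    exact (mul_smul_apply _ _ _).symm
  | succ n =>
    rw [sum_spread_succ, map_smul]
    exact (mul_smul_apply _ _ _).symm

theorem spreadAll_intertwines (ξ : FockSpace B) :
    spreadAll B I ((creation B +
      preservation (fun
        | 0 => (Fintype.card I : ℂ) • l₁
        | _ + 1 => ((Fintype.card I : ℂ) - 1) • l₁ + l₂) +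
      annihilation (fun
        | 0 => (Fintype.card I : ℂ) • α
        | _ + 1 => ((Fintype.card I : ℂ) - 1) • α)) ξ) =
      (∑ i : I, bernoulliOp l₁ l₂ α i) (spreadAll B I ξ) := by
  refine LinearMap.congr_fun (f := spreadAll B I ∘ₗ (creation B + preservation _ +
      annihilation _)) (g := (∑ i : I, bernoulliOp l₁ l₂ α i) ∘ₗ spreadAll B I)
    (fockSpace_linearMap_ext (fun b => ?_) fun n b t => ?_) ξ
  · simp only [LinearMap.comp_apply, LinearMap.add_apply, annihilation_fockBase, add_zero, map_add,
      preservation_fockBase, creation_fockBase, spreadAll_fockBase, LinearMap.sum_apply,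
      bernoulliOp_base, Finset.sum_add_distrib]
    congr 1
    · refine (spreadAll_fockIn 1 _).trans ((spread_succ 0 none 1 _).trans ?_)
      exact Finset.sum_congr rfl fun j _ => if_neg (Option.some_ne_none j).symm
    · rw [Finset.sum_const, Finset.card_univ, smul_mul_assoc, map_smul, Nat.cast_smul_eq_nsmul]
  · have hs : spreadAll B I (fockIn B (n + 1) (levelCons B n b t)) =
        ∑ j : I, pre j b (spread n (some j) t) := by
      rw [spreadAll_fockIn, spread_succ]
      exact Finset.sum_congr rfl fun j _ => if_neg (Option.some_ne_none j).symm
    have hc : spreadAll B I (creation B (fockIn B (n + 1) (levelCons B n b t))) =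
        ∑ j : I, ∑ i : I, if i = j then 0 else pre i 1 (pre j b (spread n (some j) t)) := by
      rw [creation_fockIn, spreadAll_fockIn, spread_succ, Finset.sum_comm]
      refine Finset.sum_congr rfl fun i _ => ?_
      rw [if_neg (Option.some_ne_none i).symm, spread_succ, map_sum]
      refine Finset.sum_congr rfl fun j _ => ?_
      by_cases hij : i = j <;> simp [hij]
    simp only [LinearMap.comp_apply, LinearMap.add_apply, map_add]
    rw [hc, annihilation_fockIn_succ, levelAnnihilate_levelCons, ← sum_mul_spread,
      preservation_fockIn, ← fockMul_fockIn, spreadAll_fockMul, hs, map_sum, map_sum,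
      ← Finset.sum_add_distrib, ← Finset.sum_add_distrib]
    refine Finset.sum_congr rfl fun j _ => ?_
    rw [LinearMap.sum_apply]
    exact (sum_bernoulliOp_pre l₁ l₂ α j b _).symm

theorem dist_sum_bernoulliVar :
    (probSpace B I).dist (∑ i : I, bernoulliVar l₁ l₂ α i) = jacobi
      (fun | 0 => (Fintype.card I : ℂ) • l₁ | _ + 1 => ((Fintype.card I : ℂ) - 1) • l₁ + l₂)
      (fun | 0 => (Fintype.card I : ℂ) • α | _ + 1 => ((Fintype.card I : ℂ) - 1) • α) := by
  refine LinearMap.ext fun P => ?_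
  change (probSpace B I).E (NCPoly.eval (probSpace B I).incl _ P) = _
  rw [probSpace_E, opHom_eval, map_sum (opHom B I)]
  have h := NCPoly.eval_intertwine (spreadAll B I) (fockMul B) (mulHom B I) _ _
    spreadAll_fockMul (spreadAll_intertwines l₁ l₂ α) P (vacuum B)
  rw [vacuum_eq, spreadAll_fockBase] at h
  refine (congrArg vacuumPart h.symm).trans ?_
  rw [vacuumPart_spreadAll]
  rfl

end ColouredFock

/-- Free convolution powers of Bernoulli distributions exist, are unique, and are given by their
Jacobi parameters. -/
theorem isFreeConvPower_bernoulliDist_iff {B : Type u} [Ring B] [Algebra ℂ B] (N : ℕ) (l₁ l₂ : B)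
    (α : B →ₗ[ℂ] B) (σ : NCPoly B →ₗ[ℂ] B) :
    IsFreeConvPower N (bernoulliDist l₁ l₂ α) σ ↔ σ = jacobi
      (fun | 0 => (N : ℂ) • l₁ | _ + 1 => ((N : ℂ) - 1) • l₁ + l₂)
      (fun | 0 => (N : ℂ) • α | _ + 1 => ((N : ℂ) - 1) • α) := by
  have h := ColouredFock.dist_sum_bernoulliVar (I := Fin N) l₁ l₂ α
  rw [Fintype.card_fin] at h
  rw [← h]
  constructor
  · rintro ⟨S, x, hfree, hdist, rfl⟩
    exact OVProbSpace.dist_sum_eq_of_isFree hfree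
      (ColouredFock.isFree_bernoulliVar l₁ l₂ α) fun i =>
        (hdist i).trans (ColouredFock.dist_bernoulliVar l₁ l₂ α i).symm
  · rintro rfl
    exact ⟨ColouredFock.probSpace B (Fin N), fun i => ColouredFock.bernoulliVar l₁ l₂ α i,
      ColouredFock.isFree_bernoulliVar l₁ l₂ α, ColouredFock.dist_bernoulliVar l₁ l₂ α, rfl⟩

end BernoulliSum

/-! ### Continuity of Jacobi–Szegő distributions in their parameters -/

section Limit

variable {B : Type u} [NormedRing B] [NormedAlgebra ℂ B]

/-- Sequences of tensors that are sums of a fixed number of elementary tensors, with entries that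
converge in norm, together with their limits. -/
noncomputable def levelTendsto (B : Type u) [NormedRing B] [NormedAlgebra ℂ B] :
    ∀ n : ℕ, Submodule ℂ ((ℕ → fockLevel B n) × fockLevel B n)
  | 0 => Submodule.span ℂ {p | ∃ (b : ℕ → B) (c : B), Tendsto b atTop (𝓝 c) ∧ p = (b, c)}
  | n + 1 => Submodule.span ℂ {p | ∃ (b : ℕ → B) (c : B), ∃ q ∈ levelTendsto B n,
      Tendsto b atTop (𝓝 c) ∧
        p = (fun N => levelCons B n (b N) (q.1 N), levelCons B n c q.2)}

theorem levelTendsto_base {b : ℕ → B} {c : B} (h : Tendsto b atTop (𝓝 c)) :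
    (b, c) ∈ levelTendsto B 0 :=
  Submodule.subset_span ⟨b, c, h, rfl⟩

theorem levelTendsto_cons {n : ℕ} {b : ℕ → B} {c : B} {u : ℕ → fockLevel B n} {t : fockLevel B n}
    (h : Tendsto b atTop (𝓝 c)) (hu : (u, t) ∈ levelTendsto B n) :
    (fun N => levelCons B n (b N) (u N), levelCons B n c t) ∈ levelTendsto B (n + 1) :=
  Submodule.subset_span ⟨b, c, (u, t), hu, h, rfl⟩

/-- The preimage of a space of sequences with limits under a sequence of operators. -/
def seqComap {M M' : Type*} [AddCommGroup M] [Module ℂ M] [AddCommGroup M'] [Module ℂ M']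
    (T : ℕ → M →ₗ[ℂ] M') (T₀ : M →ₗ[ℂ] M') (S : Submodule ℂ ((ℕ → M') × M')) :
    Submodule ℂ ((ℕ → M) × M) :=
  S.comap (LinearMap.prodMap (LinearMap.pi fun N => T N ∘ₗ LinearMap.proj N) T₀)

theorem tendsto_of_mem_levelTendsto_zero {u : ℕ → B} {t : B} (h : (u, t) ∈ levelTendsto B 0) :
    Tendsto u atTop (𝓝 t) := by
  let S : Submodule ℂ ((ℕ → B) × B) :=
    { carrier := {p | Tendsto p.1 atTop (𝓝 p.2)}
      add_mem' := fun {p q} hp hq => Tendsto.add hp hq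
      zero_mem' := tendsto_const_nhds
      smul_mem' := fun z p hp => Tendsto.const_smul hp z }
  have hle : levelTendsto B 0 ≤ S := by
    refine Submodule.span_le.2 ?_
    rintro _ ⟨b, c, hb, rfl⟩
    exact hb
  exact hle h

theorem levelMul_mem_levelTendsto {b : ℕ → B} {c : B} (h : Tendsto b atTop (𝓝 c)) (n : ℕ)
    {u : ℕ → fockLevel B n} {t : fockLevel B n} (hu : (u, t) ∈ levelTendsto B n) :
    (fun N => levelMul B n (b N) (u N), levelMul B n c t) ∈ levelTendsto B n := by
  have hle : levelTendsto B n ≤ seqComap (fun N => levelMul B n (b N)) (levelMul B n c)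
      (levelTendsto B n) := by
    cases n with
    | zero =>
      refine Submodule.span_le.2 ?_
      rintro _ ⟨b', c', h', rfl⟩
      exact levelTendsto_base (h.mul h')
    | succ n =>
      refine Submodule.span_le.2 ?_
      rintro _ ⟨b', c', q, hq, h', rfl⟩
      exact levelTendsto_cons (h.mul h') hq
  exact hle hu

theorem levelAnnihilate_mem_levelTendsto {alpha : ℕ → B →ₗ[ℂ] B} {alpha₀ : B →ₗ[ℂ] B}
    (h : ∀ (b : ℕ → B) (c : B), Tendsto b atTop (𝓝 c) →
      Tendsto (fun N => alpha N (b N)) atTop (𝓝 (alpha₀ c))) (n : ℕ)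
    {u : ℕ → fockLevel B (n + 1)} {t : fockLevel B (n + 1)}
    (hu : (u, t) ∈ levelTendsto B (n + 1)) :
    (fun N => levelAnnihilate (alpha N) n (u N), levelAnnihilate alpha₀ n t) ∈
      levelTendsto B n := by
  have hle : levelTendsto B (n + 1) ≤ seqComap (fun N => levelAnnihilate (alpha N) n)
      (levelAnnihilate alpha₀ n) (levelTendsto B n) := by
    refine Submodule.span_le.2 ?_
    rintro _ ⟨b, c, q, hq, hb, rfl⟩
    exact levelMul_mem_levelTendsto (h b c hb) n hq
  exact hle hu

/-- Sequences in the Fock space that converge degreewise, together with their limits. -/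
noncomputable def fockTendsto (B : Type u) [NormedRing B] [NormedAlgebra ℂ B] :
    Submodule ℂ ((ℕ → FockSpace B) × FockSpace B) :=
  Submodule.span ℂ {p | ∃ n, ∃ q ∈ levelTendsto B n,
    p = (fun N => fockIn B n (q.1 N), fockIn B n q.2)}

theorem fockIn_mem_fockTendsto {n : ℕ} {u : ℕ → fockLevel B n} {t : fockLevel B n}
    (hu : (u, t) ∈ levelTendsto B n) :
    (fun N => fockIn B n (u N), fockIn B n t) ∈ fockTendsto B :=
  Submodule.subset_span ⟨n, (u, t), hu, rfl⟩

/-- Operators that preserve convergence degree by degree. -/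
theorem map_mem_of_mem_fockTendsto {M : Type*} [AddCommGroup M] [Module ℂ M]
    {T : ℕ → FockSpace B →ₗ[ℂ] M} {T₀ : FockSpace B →ₗ[ℂ] M} {S : Submodule ℂ ((ℕ → M) × M)}
    (h : ∀ n, ∀ q ∈ levelTendsto B n,
      (fun N => T N (fockIn B n (q.1 N)), T₀ (fockIn B n q.2)) ∈ S)
    {p : (ℕ → FockSpace B) × FockSpace B} (hp : p ∈ fockTendsto B) :
    (fun N => T N (p.1 N), T₀ p.2) ∈ S := by
  have hle : fockTendsto B ≤ seqComap T T₀ S := by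
    refine Submodule.span_le.2 ?_
    rintro _ ⟨n, q, hq, rfl⟩
    exact h n q hq
  exact hle hp

theorem tendsto_vacuumComponent {u : ℕ → FockSpace B} {v : FockSpace B}
    (h : (u, v) ∈ fockTendsto B) :
    Tendsto (fun N => vacuumComponent B (u N)) atTop (𝓝 (vacuumComponent B v)) := by
  refine tendsto_of_mem_levelTendsto_zero (map_mem_of_mem_fockTendsto
    (T := fun _ => vacuumComponent B) (T₀ := vacuumComponent B) (S := levelTendsto B 0)
    (fun n q hq => ?_) h)
  cases n with
  | zero =>
    have h0 : ∀ b : B, vacuumComponent B (fockIn B 0 b) = b := vacuumComponent_fockBase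
    have h1 : (fun N => vacuumComponent B (fockIn B 0 (q.1 N))) = q.1 :=
      funext fun N => h0 (q.1 N)
    rw [h1]
    exact (congrArg (fun c => ((q.1, c) : (ℕ → fockLevel B 0) × fockLevel B 0) ∈
      levelTendsto B 0) (h0 q.2)).mpr hq
  | succ n =>
    simp only [vacuumComponent_fockIn_succ]
    exact zero_mem (levelTendsto B 0)

theorem fockMul_mem_fockTendsto (b : B) {p : (ℕ → FockSpace B) × FockSpace B}
    (hp : p ∈ fockTendsto B) :
    (fun N => fockMul B b (p.1 N), fockMul B b p.2) ∈ fockTendsto B := by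
  refine map_mem_of_mem_fockTendsto (T := fun _ => fockMul B b) (T₀ := fockMul B b)
    (S := fockTendsto B)
    (fun n q hq => ?_) hp
  simp only [fockMul_fockIn]
  exact fockIn_mem_fockTendsto (levelMul_mem_levelTendsto tendsto_const_nhds n hq)

variable {lam : ℕ → ℕ → B} {lam₀ : ℕ → B} {alpha : ℕ → ℕ → B →ₗ[ℂ] B} {alpha₀ : ℕ → B →ₗ[ℂ] B}

theorem jacobiOp_mem_fockTendsto (hlam : ∀ n, Tendsto (fun N => lam N n) atTop (𝓝 (lam₀ n)))
    (halpha : ∀ (n : ℕ) (b : ℕ → B) (c : B), Tendsto b atTop (𝓝 c) →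
      Tendsto (fun N => alpha N n (b N)) atTop (𝓝 (alpha₀ n c)))
    {p : (ℕ → FockSpace B) × FockSpace B} (hp : p ∈ fockTendsto B) :
    (fun N => (creation B + preservation (lam N) + annihilation (alpha N)) (p.1 N),
      (creation B + preservation lam₀ + annihilation alpha₀) p.2) ∈ fockTendsto B := by
  refine map_mem_of_mem_fockTendsto
    (T := fun N => creation B + preservation (lam N) + annihilation (alpha N))
    (T₀ := creation B + preservation lam₀ + annihilation alpha₀) (S := fockTendsto B)
    (fun n q hq => ?_) hp
  have hc : (fun N => creation B (fockIn B n (q.1 N)), creation B (fockIn B n q.2)) ∈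
      fockTendsto B := by
    simp only [creation_fockIn]
    exact fockIn_mem_fockTendsto (levelTendsto_cons tendsto_const_nhds hq)
  have hl : (fun N => preservation (lam N) (fockIn B n (q.1 N)),
      preservation lam₀ (fockIn B n q.2)) ∈ fockTendsto B := by
    simp only [preservation_fockIn]
    exact fockIn_mem_fockTendsto (levelMul_mem_levelTendsto (hlam n) n hq)
  have ha : (fun N => annihilation (alpha N) (fockIn B n (q.1 N)),
      annihilation alpha₀ (fockIn B n q.2)) ∈ fockTendsto B := by
    cases n with
    | zero =>
      have h0 : ∀ (β : ℕ → B →ₗ[ℂ] B) (t : fockLevel B 0),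
        annihilation β (fockIn B 0 t) = 0 := annihilation_fockBase
      simp only [h0]
      exact zero_mem (fockTendsto B)
    | succ n =>
      simp only [annihilation_fockIn_succ]
      exact fockIn_mem_fockTendsto (levelAnnihilate_mem_levelTendsto (halpha n) n hq)
  exact add_mem (add_mem hc hl) ha

theorem tendsto_jacobi (hlam : ∀ n, Tendsto (fun N => lam N n) atTop (𝓝 (lam₀ n)))
    (halpha : ∀ (n : ℕ) (b : ℕ → B) (c : B), Tendsto b atTop (𝓝 c) →
      Tendsto (fun N => alpha N n (b N)) atTop (𝓝 (alpha₀ n c))) (P : NCPoly B) :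
    Tendsto (fun N => jacobi (lam N) (alpha N) P) atTop (𝓝 (jacobi lam₀ alpha₀ P)) := by
  let R := (ℕ → Module.End ℂ (FockSpace B)) × Module.End ℂ (FockSpace B)
  let L : Subalgebra ℂ R :=
    { carrier := {T | ∀ p ∈ fockTendsto B, (fun N => T.1 N (p.1 N), T.2 p.2) ∈ fockTendsto B}
      mul_mem' := fun {S T} hS hT p hp => hS _ (hT p hp)
      add_mem' := fun {S T} hS hT p hp => add_mem (hS p hp) (hT p hp)
      algebraMap_mem' := fun z p hp => Submodule.smul_mem _ z hp }
  let j : B →ₐ[ℂ] R := (AlgHom.pi fun _ => fockMul B).prod (fockMul B)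
  let x : R := (fun N => creation B + preservation (lam N) + annihilation (alpha N),
    creation B + preservation lam₀ + annihilation alpha₀)
  have hmem : NCPoly.eval j x P ∈ L :=
    NCPoly.eval_mem L j x (fun b p hp => fockMul_mem_fockTendsto b hp)
      (fun p hp => jacobiOp_mem_fockTendsto hlam halpha hp) P
  have h1 : ∀ N, (NCPoly.eval j x P).1 N = NCPoly.eval (fockMul B) (x.1 N) P := by
    intro N
    let φ : R →ₐ[ℂ] Module.End ℂ (FockSpace B) :=
      (Pi.evalAlgHom ℂ (fun _ : ℕ => Module.End ℂ (FockSpace B)) N).comp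
        (AlgHom.fst ℂ (ℕ → Module.End ℂ (FockSpace B)) (Module.End ℂ (FockSpace B)))
    have hφ : φ.comp j = fockMul B := AlgHom.ext fun _ => rfl
    have h := NCPoly.map_eval φ j x P
    rw [hφ] at h
    exact h
  have h2 : (NCPoly.eval j x P).2 = NCPoly.eval (fockMul B) x.2 P :=
    NCPoly.map_eval (AlgHom.snd ℂ (ℕ → Module.End ℂ (FockSpace B)) _) j x P
  have hvac : (fun _ => vacuum B, vacuum B) ∈ fockTendsto B :=
    fockIn_mem_fockTendsto (n := 0) (levelTendsto_base (b := fun _ => (1 : B)) tendsto_const_nhds)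
  have h := hmem _ hvac
  simp only [h1, h2] at h
  exact tendsto_vacuumComponent h

end Limit

/-! ### The limit theorem -/

section Main

variable {B : Type u} [CStarAlgebra B]

/-- `N (1/N) c = c` up to `o(1)`. -/
theorem tendsto_natCast_smul_of_isLittleO {v : ℕ → B} {c : B}
    (h : (fun N : ℕ => v N - (1 / N : ℂ) • c) =o[atTop] (fun N : ℕ => (1 / N : ℝ))) :
    Tendsto (fun N : ℕ => (N : ℂ) • v N) atTop (𝓝 c) := by
  have h1 : (fun N : ℕ => (N : ℂ) • (v N - (1 / N : ℂ) • c)) =o[atTop]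
      (fun N : ℕ => ((N : ℂ) • ((1 / N : ℝ) : ℂ) : ℂ)) :=
    (isBigO_refl (fun N : ℕ => (N : ℂ)) atTop).smul_isLittleO
      (h.trans_isBigO (isBigO_of_le _ fun N => by simp))
  have h2 : Tendsto (fun N : ℕ => (N : ℂ) • (v N - (1 / N : ℂ) • c)) atTop (𝓝 0) := by
    refine (isLittleO_one_iff ℝ).1 (h1.trans_isBigO (IsBigO.of_bound 1 ?_))
    filter_upwards [eventually_ne_atTop 0] with N hN
    have hN' : (N : ℂ) ≠ 0 := Nat.cast_ne_zero.2 hN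
    simp [hN']
  have h3 := h2.add_const c
  rw [zero_add] at h3
  refine h3.congr' ?_
  filter_upwards [eventually_ne_atTop 0] with N hN
  have hN' : (N : ℂ) ≠ 0 := Nat.cast_ne_zero.2 hN
  rw [smul_sub, smul_smul, mul_one_div_cancel hN', one_smul, sub_add_cancel]

theorem tendsto_zero_of_tendsto_natCast_smul {v : ℕ → B} {c : B}
    (h : Tendsto (fun N : ℕ => (N : ℂ) • v N) atTop (𝓝 c)) : Tendsto v atTop (𝓝 0) := by
  have h1 : Tendsto (fun N : ℕ => ((N : ℂ))⁻¹) atTop (𝓝 0) := tendsto_inv_atTop_nhds_zero_nat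
  have h2 := h1.smul h
  rw [zero_smul] at h2
  refine h2.congr' ?_
  filter_upwards [eventually_ne_atTop 0] with N hN
  exact inv_smul_smul₀ (Nat.cast_ne_zero.2 hN) (v N)

/-- Pointwise convergent sequences of bounded operators converge along convergent sequences. -/
theorem tendsto_apply_of_pointwise {T : ℕ → B →L[ℂ] B} {T₀ : B → B}
    (h : ∀ b, Tendsto (fun N => T N b) atTop (𝓝 (T₀ b))) {b : ℕ → B} {c : B}
    (hb : Tendsto b atTop (𝓝 c)) : Tendsto (fun N => T N (b N)) atTop (𝓝 (T₀ c)) := by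
  obtain ⟨C, hC⟩ := banach_steinhaus (g := T) fun b => by
    obtain ⟨C, hC⟩ := (h b).norm.bddAbove_range
    exact ⟨C, fun N => hC ⟨N, rfl⟩⟩
  have h1 : Tendsto (fun N => T N (b N - c)) atTop (𝓝 0) := by
    refine squeeze_zero_norm (fun N => (T N).le_of_opNorm_le (hC N) _) ?_
    have h2 := (tendsto_iff_norm_sub_tendsto_zero.1 hb).const_mul C
    rwa [mul_zero] at h2
  have h3 := h1.add (h c)
  rw [zero_add] at h3
  refine h3.congr fun N => ?_
  rw [map_sub, sub_add_cancel]

end Main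

theorem mainTheorem10 {B : Type u} [CStarAlgebra B] [PartialOrder B] [StarOrderedRing B]
    (lam₁ lam : B) (hlam₁ : IsSelfAdjoint lam₁) (hlam : IsSelfAdjoint lam) (α : B →CP B)
    (l₁ l₂ : ℕ → B) (hl₁ : ∀ N, IsSelfAdjoint (l₁ N)) (hl₂ : ∀ N, IsSelfAdjoint (l₂ N))
    (a : ℕ → (B →CP B))
    (hl₁_lim : (fun N : ℕ => l₁ N - (1 / N : ℂ) • lam₁) =o[atTop] (fun N : ℕ => (1 / N : ℝ)))
    (hl₂_lim : (fun N : ℕ => l₂ N - ((1 / N : ℂ) • lam₁ + lam)) =o[atTop] (fun _ : ℕ => (1 : ℝ)))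
    (ha_lim : ∀ b : B,
      (fun N : ℕ => a N b - (1 / N : ℂ) • α b) =o[atTop] (fun N : ℕ => (1 / N : ℝ))) :
    ∃ ρ : ℕ → (NCPoly B →ₗ[ℂ] B),
      (∀ (N : ℕ) (σ : NCPoly B →ₗ[ℂ] B),
        IsFreeConvPower N (bernoulliDist (l₁ N) (l₂ N) (a N).toLinearMap) σ ↔ σ = ρ N) ∧
      ∀ P : NCPoly B,
        Tendsto (fun N => ρ N P) atTop (𝓝 (freePoissonDist lam₁ lam α.toLinearMap P)) := by
  refine ⟨_, fun N σ => isFreeConvPower_bernoulliDist_iff N (l₁ N) (l₂ N) (a N).toLinearMap σ,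
    fun P => ?_⟩
  have h1 := tendsto_natCast_smul_of_isLittleO hl₁_lim
  have h1' := tendsto_zero_of_tendsto_natCast_smul h1
  have h2 : Tendsto l₂ atTop (𝓝 lam) := by
    have h3 : Tendsto (fun N : ℕ => (1 / N : ℂ) • lam₁ + lam) atTop (𝓝 lam) := by
      have h4 := (tendsto_one_div_atTop_nhds_zero_nat (𝕜 := ℂ)).smul_const lam₁
      have h5 := h4.add_const lam
      rwa [zero_smul, zero_add] at h5
    have h6 := ((isLittleO_one_iff ℝ).1 hl₂_lim).add h3
    rw [zero_add] at h6
    exact h6.congr fun N => sub_add_cancel _ _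
  have ha : ∀ b, Tendsto (fun N : ℕ => (N : ℂ) • a N b) atTop (𝓝 (α b)) := fun b =>
    tendsto_natCast_smul_of_isLittleO (ha_lim b)
  let A : ℕ → B →L[ℂ] B := fun N => ⟨(a N).toLinearMap, map_continuous (a N)⟩
  refine tendsto_jacobi (fun n => ?_) (fun n b c hb => ?_) P
  · cases n with
    | zero => exact h1
    | succ n =>
      have h3 := (h1.sub h1').add h2
      rw [sub_zero] at h3
      refine h3.congr fun N => ?_
      rw [sub_smul, one_smul]
  · cases n with
    | zero =>
      exact tendsto_apply_of_pointwise (T := fun N => (N : ℂ) • A N) (T₀ := α) ha hb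
    | succ n =>
      refine tendsto_apply_of_pointwise (T := fun N => ((N : ℂ) - 1) • A N) (T₀ := α)
        (fun b => ?_) hb
      have h3 := (ha b).sub (tendsto_zero_of_tendsto_natCast_smul (ha b))
      rw [sub_zero] at h3
      refine h3.congr fun N => ?_
      change (N : ℂ) • a N b - a N b = ((N : ℂ) - 1) • a N b
      rw [sub_smul, one_smul]
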